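/- Let $N$ be a positive integer, $1<p<N$, $0\le\mu<\left(\frac{N-p}{p}\right)^{p}$, $m>0$, and let $f:\mathbb{R}\to\mathbb{R}$ be continuous with $$\limsup_{t\to0}\frac{|f(t)|}{|t|^{q-1}}<\infty\qquad\text{for some } q>p .$$ Let $u\in W^{1,p}(\mathbb{R}^{N})$ be a positive radial weak solution of $$-\Delta_{p}u-\frac{\mu}{|x|^{p}}|u|^{p-2}u+m|u|^{p-2}u=f(u)\quad\text{in }\mathbb{R}^{N},$$ where $\Delta_p u=\operatorname{div}(|\nabla u|^{p-2}\nabla u)$. That is, for every nonnegative $\varphi\in C_{0}^{\infty}(\mathbb{R}^{N})$ the function $f(u)\varphi$ is integrable and $$\int_{\mathbb{R}^{N}}\left(|\nabla u|^{p-2}\nabla u\cdot\nabla\varphi-\frac{\mu}{|x|^{p}}|u|^{p-2}u\varphi+m|u|^{p-2}u\varphi\right)=\int_{\mathbb{R}^{N}}f(u)\varphi .$$ Let $k$ be the integer with $k\le p<k+1$. Then, after modification on a null set, $u(x)=u(r)$ with $r=|x|$, where $r\mapsto u(r)$ is positive and continuously differentiable on $(0,\infty)$; moreover $u'(r)<0$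 for all sufficiently large $r$, and $$\left(-\frac{u'(r)}{u(r)}\right)^{p-1}=\sum_{i=0}^{k}\frac{c_{i}}{r^{i}}-\frac{((p-1)/m)^{1/p}\,\mu}{p\,r^{p}}+O\left(\frac{1}{r^{k+1}}\right)\qquad\text{as }r\to\infty,$$ where $$c_{0}=\left(\frac{m}{p-1}\right)^{\frac{p-1}{p}},\qquad c_{1}=\frac{N-1}{p}\left(\frac{m}{p-1}\right)^{\frac{p-2}{p}},$$ and $c_{2},\dots,c_{k}$ are determined uniquely by the relations, for $2\le i\le k$, $$(N-i)c_{i-1}-p\left(\frac{m}{p-1}\right)^{\frac1p}c_{i}=\sum_{n=2}^{i}\frac{F^{(n)}(0)}{n!}\sum_{\substack{j_{1}+\cdots+j_{n}=i\\ j_{1},\dots,j_{n}>0}}c_{j_{1}}c_{j_{2}}\cdots c_{j_{n}},$$ with $F^{(n)}(0)$ the $n$-th derivative at $t=0$ of $F(t)=(p-1)(c_{0}+t)^{\frac{p}{p-1}}$. -/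

import Mathlib

open MeasureTheory Filter Topology Asymptotics
open scoped ContDiff

noncomputable section

namespace HardyPLaplace

/-- The Euclidean space `ℝ^N`. -/
abbrev E (N : ℕ) := EuclideanSpace ℝ (Fin N)

/-- `φ ∈ C_0^∞(ℝ^N)`: smooth functions with compact support. -/
def IsTestFunction {N : ℕ} (φ : E N → ℝ) : Prop :=
  ContDiff ℝ ∞ φ ∧ HasCompactSupport φ

/-- `G` is the weak gradient of `u` on `ℝ^N`: its components are the first order weak partial
derivatives of `u`. -/
def IsWeakGradient {N : ℕ} (u : E N → ℝ) (G : E N → E N) : Prop :=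
  LocallyIntegrable u volume ∧ LocallyIntegrable G volume ∧
    ∀ φ : E N → ℝ, IsTestFunction φ → ∀ i : Fin N,
      ∫ x, u x * fderiv ℝ φ x (EuclideanSpace.single i 1) = -∫ x, G x i * φ x

/-- `u ∈ W^{1,p}(ℝ^N)`, with weak gradient `G`. -/
def MemW1p {N : ℕ} (p : ℝ) (u : E N → ℝ) (G : E N → E N) : Prop :=
  MemLp u (ENNReal.ofReal p) volume ∧ MemLp G (ENNReal.ofReal p) volume ∧ IsWeakGradient u G

/-- The left-hand side of the weak formulation,
`∫ (|∇u|^{p-2} ∇u·∇φ - μ |x|^{-p} |u|^{p-2} u φ + m |u|^{p-2} u φ)`, where `G = ∇u`. -/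
def weakForm {N : ℕ} (p μ m : ℝ) (u : E N → ℝ) (G : E N → E N) (φ : E N → ℝ) : ℝ :=
  ∫ x, (‖G x‖ ^ (p - 2) * inner ℝ (G x) (gradient φ x)
    - μ / ‖x‖ ^ p * (|u x| ^ (p - 2) * u x) * φ x
    + m * (|u x| ^ (p - 2) * u x) * φ x)

/-- `u ∈ W^{1,p}(ℝ^N)` is a weak subsolution of
`-Δ_p u - μ |x|^{-p} |u|^{p-2} u + m |u|^{p-2} u = f(u)`. The integrability of `f(u) φ` is what
gives the right-hand side of the weak formulation a meaning when `f` has no growth restriction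
at infinity; the integrand of the left-hand side is always integrable, by the inequalities of
Hölder and Hardy. -/
def IsWeakSubsolution {N : ℕ} (p μ m : ℝ) (f : ℝ → ℝ) (u : E N → ℝ) : Prop :=
  ∃ G : E N → E N, MemW1p p u G ∧
    ∀ φ : E N → ℝ, IsTestFunction φ → (∀ x, 0 ≤ φ x) →
      Integrable (fun x => f (u x) * φ x) volume ∧
        weakForm p μ m u G φ ≤ ∫ x, f (u x) * φ x

/-- `u ∈ W^{1,p}(ℝ^N)` is a weak supersolution of the same equation. -/
def IsWeakSupersolution {N : ℕ} (p μ m : ℝ) (f : ℝ → ℝ) (u : E N → ℝ) : Prop :=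
  ∃ G : E N → E N, MemW1p p u G ∧
    ∀ φ : E N → ℝ, IsTestFunction φ → (∀ x, 0 ≤ φ x) →
      Integrable (fun x => f (u x) * φ x) volume ∧
        ∫ x, f (u x) * φ x ≤ weakForm p μ m u G φ

/-- A weak solution is both a weak subsolution and a weak supersolution. -/
def IsWeakSolution {N : ℕ} (p μ m : ℝ) (f : ℝ → ℝ) (u : E N → ℝ) : Prop :=
  IsWeakSubsolution p μ m f u ∧ IsWeakSupersolution p μ m f u

/-- `v` is a radial profile of `u`: `u(x) = v(|x|)` for almost every `x`. -/
def IsProfile {N : ℕ} (u : E N → ℝ) (v : ℝ → ℝ) : Prop :=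
  ∀ᵐ x : E N, u x = v ‖x‖

/-- `u` is (almost everywhere equal to) a radially symmetric function. -/
def IsRadial {N : ℕ} (u : E N → ℝ) : Prop := ∃ v : ℝ → ℝ, IsProfile u v

/-- `limsup_{t → 0} |f(t)| / |t|^{q-1} ≤ A`, the upper limit being taken in `[-∞, ∞]`. -/
def GrowthAtZero (f : ℝ → ℝ) (q A : ℝ) : Prop :=
  limsup (fun t : ℝ => ((|f t| / |t| ^ (q - 1) : ℝ) : EReal)) (𝓝[≠] (0 : ℝ)) ≤ (A : EReal)

/-- The function `F(t) = (p-1) (c₀ + t)^{p/(p-1)}`. -/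
def auxF (p c₀ t : ℝ) : ℝ := (p - 1) * (c₀ + t) ^ (p / (p - 1))

/-- The sum of `c_{j₁} ⋯ c_{jₙ}` over all `j₁, …, jₙ > 0` with `j₁ + ⋯ + jₙ = i`. -/
def compSum (c : ℕ → ℝ) (n i : ℕ) : ℝ :=
  ∑ j ∈ (Finset.Nat.antidiagonalTuple n i).filter (fun j => ∀ l, 0 < j l), ∏ l, c (j l)

/-- The relations that determine `c₀, …, c_k`. -/
def IsCoeffs (N : ℕ) (p m : ℝ) (k : ℕ) (c : ℕ → ℝ) : Prop :=
  c 0 = (m / (p - 1)) ^ ((p - 1) / p) ∧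
  c 1 = ((N : ℝ) - 1) / p * (m / (p - 1)) ^ ((p - 2) / p) ∧
  ∀ i : ℕ, 2 ≤ i → i ≤ k →
    ((N : ℝ) - i) * c (i - 1) - p * (m / (p - 1)) ^ (1 / p) * c i =
      ∑ n ∈ Finset.Icc 2 i,
        iteratedDeriv n (auxF p (c 0)) 0 / (n.factorial : ℝ) * compSum c n i

end HardyPLaplace

end

/-!
The proof reduces the weak equation to an ordinary differential equation for the profile and then
to a Riccati equation whose equilibrium is repelling, so that its global positive solutions are
determined up to any order by a formal expansion.

*Reduction to the radial equation.* Testing the definition of the weak gradient `G` with the vector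
fields `η(|x|) |x| ^ (-N) x` shows that the profile of `u` has a weak derivative `w` on `(0, ∞)`
(`IsWeakGradient.hasWeakDeriv_profile`); by the lemma of du Bois-Reymond
(`HasWeakDeriv.ae_eq_primitive`) the profile is a primitive of `w`, and by uniqueness of weak
gradients `G x = w(|x|) x / |x|` (`IsWeakGradient.ae_eq_radial`). Radial test functions in the weak
formulation then give the weak derivative of the flux `r ^ (N - 1) |w| ^ (p - 2) w`, which is
continuous; hence the flux is `C¹`, `w` is continuous, and the profile `v` is a `C¹` solution of the
radial equation (`IsWeakSolution.exists_isRadialSolution`).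

*Qualitative properties.* Since `f(t) = O(t ^ (q - 1))` with `q > p`, the Cauchy problem with zero
data has only the zero solution, so `v > 0` everywhere (`IsRadialSolution.pos`). Integrability of
`v ^ p` and `|v'| ^ p` forces `v → 0`, and as the flux is increasing for large `r`, `v' < 0` there.

*The expansion.* The function `h = (-v' / v) ^ (p - 1)` solves
`h' = (p - 1) h ^ (p / (p - 1)) - (N - 1) h / r - m + μ / r ^ p + f(v) / v ^ (p - 1)`.
Above the equilibrium `c₀` a solution blows up in finite time, below it it becomes negative, so
`h → c₀` (`riccati_tendsto`). Hence `v` decays exponentially and the term with `f` is smaller than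
any power of `r`. The relations for the `c_i` say that `expansion` solves the same equation up to
`O(r ^ (-(k + 1)))` (`expansion_residual_isBigO`). The difference of `h` and `expansion` tends to
zero and solves a linear equation with growth rate bounded below, so it is of the size of the
source term (`riccati_compare`).
-/

namespace HardyPLaplace

noncomputable section

/-! ### The formal solution of the Riccati equation -/

lemma compSum_eq_zero_of_lt (c : ℕ → ℝ) {n i : ℕ} (h : i < n) : compSum c n i = 0 := by
  unfold compSum
  refine Finset.sum_eq_zero fun j hj => ?_
  simp only [Finset.mem_filter, Finset.Nat.mem_antidiagonalTuple] at hj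
  have : ∑ _l : Fin n, 1 ≤ ∑ l, j l := Finset.sum_le_sum fun l _ => hj.2 l
  simp at this
  omega

/-- For `n ≥ 2` every index in the sum defining `compSum c n i` is smaller than `i`. -/
lemma compSum_congr {c d : ℕ → ℝ} {n i : ℕ} (hn : 2 ≤ n) (h : ∀ j, 0 < j → j < i → c j = d j) :
    compSum c n i = compSum d n i := by
  unfold compSum
  refine Finset.sum_congr rfl fun j hj => Finset.prod_congr rfl fun l _ => ?_
  simp only [Finset.mem_filter, Finset.Nat.mem_antidiagonalTuple] at hj
  refine h _ (hj.2 l) ?_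
  obtain ⟨l', hl'⟩ : ∃ l' : Fin n, l' ≠ l := by
    have : Nontrivial (Fin n) := Fin.nontrivial_iff_two_le.2 hn
    exact exists_ne l
  have h1 : j l + j l' ≤ ∑ x, j x := by
    rw [← Finset.sum_pair hl'.symm]
    exact Finset.sum_le_sum_of_subset (Finset.subset_univ _)
  have := hj.2 l'
  omega

lemma exists_isCoeffs (N : ℕ) {p m : ℝ} (hp : 1 < p) (hm : 0 < m) (k : ℕ) :
    ∃ c, IsCoeffs N p m k c := by
  have hlam : p * (m / (p - 1)) ^ (1 / p) ≠ 0 := by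
    have : 0 < m / (p - 1) := div_pos hm (by linarith)
    positivity
  induction k with
  | zero =>
    refine ⟨fun i => if i = 0 then (m / (p - 1)) ^ ((p - 1) / p)
      else ((N : ℝ) - 1) / p * (m / (p - 1)) ^ ((p - 2) / p), by simp, by simp, ?_⟩
    intro i h2 h0
    omega
  | succ k ih =>
    obtain ⟨c, h0, h1, hc⟩ := ih
    by_cases hk : k = 0
    · refine ⟨c, h0, h1, ?_⟩
      intro i h2 h0
      omega
    set R : ℝ := ∑ n ∈ Finset.Icc 2 (k + 1),
        iteratedDeriv n (auxF p (c 0)) 0 / (n.factorial : ℝ) * compSum c n (k + 1)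
    set x : ℝ := (((N : ℝ) - (k + 1 : ℕ)) * c k - R) / (p * (m / (p - 1)) ^ (1 / p))
    have hne : ∀ j, j ≠ k + 1 → Function.update c (k + 1) x j = c j := fun j hj => by simp [hj]
    refine ⟨Function.update c (k + 1) x, by rw [hne 0 (by omega), h0],
      by rw [hne 1 (by omega), h1], fun i h2 hi => ?_⟩
    have hS : ∀ n ∈ Finset.Icc 2 i, compSum (Function.update c (k + 1) x) n i = compSum c n i :=
      fun n hn => compSum_congr (Finset.mem_Icc.1 hn).1 fun j _ hj => hne j (by omega)
    rw [hne 0 (by omega), hne (i - 1) (by omega), Finset.sum_congr rfl fun n hn => by rw [hS n hn]]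
    rcases hi.lt_or_eq with hlt | rfl
    · rw [hne i (by omega)]
      exact hc i h2 (by omega)
    · simp only [Function.update_self, Nat.add_sub_cancel, x]
      rw [mul_div_cancel₀ _ hlam]
      ring

lemma IsCoeffs.unique {N : ℕ} {p m : ℝ} (hp : 1 < p) (hm : 0 < m) {k : ℕ} {c d : ℕ → ℝ}
    (hc : IsCoeffs N p m k c) (hd : IsCoeffs N p m k d) : ∀ i ≤ k, d i = c i := by
  have hlam : p * (m / (p - 1)) ^ (1 / p) ≠ 0 := by
    have : 0 < m / (p - 1) := div_pos hm (by linarith)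
    positivity
  intro i
  induction i using Nat.strong_induction_on with
  | _ i ih =>
    intro hi
    have h0 : d 0 = c 0 := by rw [hd.1, hc.1]
    rcases lt_or_ge i 2 with h2 | h2
    · interval_cases i
      · exact h0
      · rw [hd.2.1, hc.2.1]
    · have e1 := hc.2.2 i h2 hi
      have e2 := hd.2.2 i h2 hi
      rw [h0, Finset.sum_congr rfl fun n hn => by
        rw [compSum_congr (c := d) (d := c) (Finset.mem_Icc.1 hn).1
          fun j _ hj => ih j hj (by omega)], ← e1, ih (i - 1) (by omega) (by omega)] at e2
      exact mul_left_cancel₀ hlam (by linarith)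

/-- `compSum c n i` is the coefficient of `s ^ i` in `(∑ c_i s ^ i) ^ n`. -/
lemma pow_sum_sub_compSum_isBigO (c : ℕ → ℝ) (k n : ℕ) :
    (fun s : ℝ => (∑ i ∈ Finset.Icc 1 k, c i * s ^ i) ^ n
      - ∑ i ∈ Finset.range (k + 1), compSum c n i * s ^ i) =O[𝓝 0] fun s => s ^ (k + 1) := by
  set A := Fintype.piFinset fun _ : Fin n => Finset.Icc 1 k
  have h1 : ∀ s : ℝ, (∑ i ∈ Finset.Icc 1 k, c i * s ^ i) ^ n
      = ∑ j ∈ A, (∏ l, c (j l)) * s ^ (∑ l, j l) := by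
    intro s
    have := Finset.prod_univ_sum (fun _ : Fin n => Finset.Icc 1 k) (fun _ i => c i * s ^ i)
    simp only [Finset.prod_const, Finset.card_univ, Fintype.card_fin] at this
    rw [this]
    refine Finset.sum_congr rfl fun j _ => ?_
    rw [Finset.prod_mul_distrib, Finset.prod_pow_eq_pow_sum]
  have h2 : ∀ s : ℝ, ∑ i ∈ Finset.range (k + 1), compSum c n i * s ^ i
      = ∑ j ∈ A with ∑ l, j l ∈ Finset.range (k + 1), (∏ l, c (j l)) * s ^ (∑ l, j l) := by
    intro s
    rw [← Finset.sum_fiberwise_of_maps_to (s := {j ∈ A | ∑ l, j l ∈ Finset.range (k + 1)})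
      (t := Finset.range (k + 1)) (g := fun j => ∑ l, j l)
      (fun j hj => (Finset.mem_filter.1 hj).2)]
    refine Finset.sum_congr rfl fun i hi => ?_
    rw [compSum, Finset.sum_mul]
    refine Finset.sum_congr ?_ fun j hj => ?_
    · ext j
      simp only [Finset.mem_filter, Finset.Nat.mem_antidiagonalTuple, A, Fintype.mem_piFinset,
        Finset.mem_Icc, Finset.mem_range] at hi ⊢
      constructor
      · rintro ⟨h, hpos⟩
        refine ⟨⟨fun l => ⟨hpos l, ?_⟩, by omega⟩, h⟩
        have := Finset.single_le_sum (f := j) (fun _ _ => Nat.zero_le _) (Finset.mem_univ l)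
        omega
      · rintro ⟨⟨h, _⟩, h'⟩
        exact ⟨h', fun l => (h l).1⟩
    · rw [(Finset.mem_filter.1 hj).2]
  have h3 : ∀ s : ℝ, (∑ i ∈ Finset.Icc 1 k, c i * s ^ i) ^ n
      - ∑ i ∈ Finset.range (k + 1), compSum c n i * s ^ i
      = ∑ j ∈ A with ¬ ∑ l, j l ∈ Finset.range (k + 1), (∏ l, c (j l)) * s ^ (∑ l, j l) := by
    intro s
    rw [h1, h2, ← Finset.sum_filter_add_sum_filter_not A
      (fun j => ∑ l, j l ∈ Finset.range (k + 1))]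
    ring
  simp only [h3]
  refine IsBigO.fun_sum fun j hj => ?_
  refine IsBigO.const_mul_left ?_ _
  simp only [Finset.mem_filter, Finset.mem_range, not_lt] at hj
  have h := (isBigO_refl (fun s : ℝ => s ^ (k + 1)) (𝓝 0)).mul
    (show (fun s : ℝ => s ^ (∑ l, j l - (k + 1))) =O[𝓝 0] fun _ => (1 : ℝ) from
      (Continuous.tendsto (by fun_prop) 0).isBigO_one ℝ)
  refine (h.congr (fun s => ?_) fun s => mul_one _)
  rw [← pow_add]
  congr 1
  omega

lemma analyticAt_auxF {p c₀ : ℝ} (hc : 0 < c₀) : AnalyticAt ℝ (auxF p c₀) 0 := by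
  unfold auxF
  refine analyticAt_const.mul ?_
  have h : AnalyticAt ℝ (fun t : ℝ => c₀ + t) 0 := by fun_prop
  refine ContDiffAt.analyticAt ?_
  exact h.contDiffAt.rpow_const_of_ne (by simpa using hc.ne')

lemma auxF_sub_taylor_isBigO {p c₀ : ℝ} (hc : 0 < c₀) (k : ℕ) :
    (fun t : ℝ => auxF p c₀ t
      - ∑ n ∈ Finset.range (k + 1), iteratedDeriv n (auxF p c₀) 0 / (n.factorial : ℝ) * t ^ n)
      =O[𝓝 0] fun t => t ^ (k + 1) := by
  have := (analyticAt_auxF (p := p) hc).hasFPowerSeriesAt.isBigO_sub_partialSum_pow (k + 1)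
  simp only [zero_add, FormalMultilinearSeries.partialSum,
    FormalMultilinearSeries.ofScalars_apply_eq, smul_eq_mul, ← norm_pow] at this
  exact this.of_norm_right

lemma IsCoeffs.coeff_zero_pos {N : ℕ} {p m : ℝ} (hp : 1 < p) (hm : 0 < m) {k : ℕ} {c : ℕ → ℝ}
    (hc : IsCoeffs N p m k c) : 0 < c 0 := by
  have : 0 < m / (p - 1) := div_pos hm (by linarith)
  rw [hc.1]
  positivity

lemma IsCoeffs.coeff_zero_rpow {N : ℕ} {p m : ℝ} (hp : 1 < p) (hm : 0 < m) {k : ℕ} {c : ℕ → ℝ}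
    (hc : IsCoeffs N p m k c) : (p - 1) * c 0 ^ (p / (p - 1)) = m := by
  have h1 : 0 < p - 1 := by linarith
  have : 0 < m / (p - 1) := div_pos hm h1
  rw [hc.1, ← Real.rpow_mul this.le, show (p - 1) / p * (p / (p - 1)) = 1 by field_simp,
    Real.rpow_one]
  field_simp

lemma IsCoeffs.coeff_zero_rpow' {N : ℕ} {p m : ℝ} (hp : 1 < p) (hm : 0 < m) {k : ℕ} {c : ℕ → ℝ}
    (hc : IsCoeffs N p m k c) : c 0 ^ (1 / (p - 1)) = (m / (p - 1)) ^ (1 / p) := by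
  have h1 : 0 < p - 1 := by linarith
  have : 0 < m / (p - 1) := div_pos hm h1
  rw [hc.1, ← Real.rpow_mul this.le]
  congr 1
  field_simp

lemma iteratedDeriv_one_auxF {p c₀ : ℝ} (hp : 1 < p) (hc : 0 < c₀) :
    iteratedDeriv 1 (auxF p c₀) 0 = p * c₀ ^ (1 / (p - 1)) := by
  have h1 : 0 < p - 1 := by linarith
  rw [iteratedDeriv_one]
  have h := (((hasDerivAt_id (0 : ℝ)).const_add c₀).rpow_const (p := p / (p - 1))
    (Or.inl (by simpa using hc.ne'))).const_mul (p - 1)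
  have h' : HasDerivAt (auxF p c₀) _ 0 := h
  rw [h'.deriv]
  have e : p / (p - 1) - 1 = 1 / (p - 1) := by field_simp; ring
  simp only [id, add_zero, e]
  field_simp

/-- The relation between the coefficients, in a form that covers `i = 1` as well. -/
lemma IsCoeffs.recurrence {N : ℕ} {p m : ℝ} (hp : 1 < p) (hm : 0 < m) {k : ℕ} {c : ℕ → ℝ}
    (hc : IsCoeffs N p m k c) {i : ℕ} (h1 : 1 ≤ i) (hi : i ≤ k) :
    ((N : ℝ) - i) * c (i - 1) - p * (m / (p - 1)) ^ (1 / p) * c i =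
      ∑ n ∈ Finset.Icc 2 k,
        iteratedDeriv n (auxF p (c 0)) 0 / (n.factorial : ℝ) * compSum c n i := by
  have hsub : ∑ n ∈ Finset.Icc 2 i,
        iteratedDeriv n (auxF p (c 0)) 0 / (n.factorial : ℝ) * compSum c n i
      = ∑ n ∈ Finset.Icc 2 k,
        iteratedDeriv n (auxF p (c 0)) 0 / (n.factorial : ℝ) * compSum c n i := by
    refine Finset.sum_subset (Finset.Icc_subset_Icc_right hi) fun n hn hn' => ?_
    simp only [Finset.mem_Icc, not_and, not_le] at hn hn'
    rw [compSum_eq_zero_of_lt c (hn' hn.1), mul_zero]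
  rw [← hsub]
  rcases h1.lt_or_eq with h2 | rfl
  · exact hc.2.2 i h2 hi
  · have h1 : 0 < p - 1 := by linarith
    have hpos : 0 < m / (p - 1) := div_pos hm h1
    simp only [hc.1, hc.2.1, Nat.sub_self, Nat.cast_one]
    rw [show (p - 1) / p = 1 / p + (p - 2) / p by ring, Real.rpow_add hpos]
    simp only [show Finset.Icc 2 1 = ∅ from rfl, Finset.sum_empty]
    field_simp
    ring

lemma sum_Icc_add_zero_eq (g : ℕ → ℝ) (k : ℕ) :
    ∑ i ∈ Finset.Icc 1 k, g i + g 0 = ∑ i ∈ Finset.Icc 1 k, g (i - 1) + g k := by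
  induction k with
  | zero => simp
  | succ k ih =>
    rw [Finset.sum_Icc_succ_top (by omega), Finset.sum_Icc_succ_top (by omega),
      Nat.add_sub_cancel]
    linarith

/-- The truncated expansion of `(-u' / u) ^ (p - 1)`. -/
def expansion (p μ m : ℝ) (k : ℕ) (c : ℕ → ℝ) (r : ℝ) : ℝ :=
  ∑ i ∈ Finset.range (k + 1), c i / r ^ i - ((p - 1) / m) ^ (1 / p) * μ / (p * r ^ p)

/-- The derivative of `expansion`. -/
def expansionDeriv (p μ m : ℝ) (k : ℕ) (c : ℕ → ℝ) (r : ℝ) : ℝ :=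
  -∑ i ∈ Finset.range (k + 1), i * c i / r ^ (i + 1)
    + ((p - 1) / m) ^ (1 / p) * μ / r ^ (p + 1)

lemma hasDerivAt_expansion {p μ m : ℝ} (hp : 1 < p) (k : ℕ) (c : ℕ → ℝ) {r : ℝ} (hr : 0 < r) :
    HasDerivAt (expansion p μ m k c) (expansionDeriv p μ m k c r) r := by
  have h1 : ∀ i ∈ Finset.range (k + 1),
      HasDerivAt (fun r : ℝ => c i / r ^ i) (-(i * c i / r ^ (i + 1))) r := by
    intro i _
    have h := (hasDerivAt_pow i r).inv (by positivity) |>.const_mul (c i)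
    refine h.congr_deriv ?_
    rcases i with _ | i
    · simp
    · simp only [Nat.add_sub_cancel]
      field_simp
      ring
  have h2 := (((Real.hasDerivAt_rpow_const (p := p) (Or.inl hr.ne')).const_mul p).inv
    (by positivity)).const_mul (((p - 1) / m) ^ (1 / p) * μ)
  have h := (HasDerivAt.fun_sum h1).sub h2
  refine h.congr_deriv ?_
  rw [expansionDeriv, Finset.sum_neg_distrib, sub_eq_add_neg]
  congr 1
  have e : r ^ p = r ^ (p - 1) * r := by
    rw [← Real.rpow_add_one hr.ne']; congr 1; ring
  rw [Real.rpow_add_one hr.ne', e]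
  field_simp

/-- `expansion` solves the Riccati equation up to an error of order `r ^ (-(k + 1))`. -/
lemma expansion_residual_isBigO {N : ℕ} {p μ m : ℝ} (hp : 1 < p) (hm : 0 < m) {k : ℕ}
    (hk : (k : ℝ) ≤ p) (hk' : p < (k : ℝ) + 1) {c : ℕ → ℝ} (hc : IsCoeffs N p m k c) :
    (fun r : ℝ => (p - 1) * expansion p μ m k c r ^ (p / (p - 1))
      - ((N : ℝ) - 1) / r * expansion p μ m k c r - m + μ / r ^ p - expansionDeriv p μ m k c r)
      =O[atTop] fun r : ℝ => 1 / r ^ (k + 1) := by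
  have hk1 : 1 ≤ k := by
    by_contra h
    have : k = 0 := by omega
    subst this
    norm_num at hk'
    linarith
  have hp0 : 0 < p := by linarith
  have hp1 : 0 < p - 1 := by linarith
  have hc0 := hc.coeff_zero_pos hp hm
  set s : ℝ → ℝ := fun r => r⁻¹ with hs
  have hs0 : Tendsto s atTop (𝓝 0) := tendsto_inv_atTop_zero
  set κ : ℝ := ((p - 1) / m) ^ (1 / p) * μ / p with hκ
  set lam : ℝ := p * (m / (p - 1)) ^ (1 / p) with hlam
  have hlamκ : lam * κ = μ := by
    rw [hlam, hκ, show (p - 1) / m = (m / (p - 1))⁻¹ by simp,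
      Real.inv_rpow (div_pos hm hp1).le]
    have : 0 < (m / (p - 1)) ^ (1 / p) := by
      have := div_pos hm hp1
      positivity
    field_simp
  set w : ℝ → ℝ := fun r => κ / r ^ p with hw
  set T : ℝ → ℝ := fun r => ∑ i ∈ Finset.Icc 1 k, c i * s r ^ i with hT
  set t : ℝ → ℝ := fun r => T r - w r with ht
  set a : ℕ → ℝ := fun n => iteratedDeriv n (auxF p (c 0)) 0 / (n.factorial : ℝ) with ha
  have ha0 : a 0 = m := by
    simp only [ha, iteratedDeriv_zero, auxF, add_zero, Nat.factorial_zero, Nat.cast_one, div_one]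
    exact hc.coeff_zero_rpow hp hm
  have ha1 : a 1 = lam := by
    simp only [ha, iteratedDeriv_one_auxF hp hc0, Nat.factorial_one, Nat.cast_one, div_one, hlam]
    rw [hc.coeff_zero_rpow' hp hm]
  have hpow_le : ∀ {i j : ℕ}, j ≤ i → (fun r => s r ^ i) =O[atTop] fun r => s r ^ j := by
    intro i j hij
    refine IsBigO.of_bound 1 ?_
    filter_upwards [eventually_ge_atTop 1] with r hr
    have h1 : s r ≤ 1 := inv_le_one_of_one_le₀ hr
    have h0 : 0 ≤ s r := by simp only [hs]; positivity
    rw [one_mul, Real.norm_of_nonneg (by positivity), Real.norm_of_nonneg (by positivity)]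
    exact pow_le_pow_of_le_one h0 h1 hij
  have hwk : w =O[atTop] fun r => s r ^ k := by
    refine IsBigO.of_bound |κ| ?_
    filter_upwards [eventually_ge_atTop 1] with r hr
    have hr0 : 0 < r := by linarith
    simp only [hw, hs, norm_div, Real.norm_eq_abs, inv_pow]
    rw [abs_of_pos (Real.rpow_pos_of_pos hr0 p), abs_of_pos (by positivity : 0 < (r ^ k)⁻¹),
      div_eq_mul_inv]
    gcongr
    rw [← Real.rpow_natCast]
    exact Real.rpow_le_rpow_of_exponent_le hr hk
  have hTs : T =O[atTop] s := by
    refine IsBigO.fun_sum fun i hi => IsBigO.const_mul_left ?_ _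
    simpa using hpow_le (Finset.mem_Icc.1 hi).1
  have hws : w =O[atTop] s := hwk.trans (by simpa using hpow_le hk1)
  have hts : t =O[atTop] s := hTs.sub hws
  have ht0 : Tendsto t atTop (𝓝 0) := hts.trans_tendsto hs0
  have hmulw : ∀ {g : ℝ → ℝ}, g =O[atTop] s → (fun r => g r * w r) =O[atTop]
      fun r => s r ^ (k + 1) := by
    intro g hg
    exact (hg.mul hwk).congr_right fun r => by ring
  -- Four errors are of order `k + 1`: the Taylor remainder of `auxF` at `t = T - w`, replacing `t`
  -- by its polynomial part `T` in the powers `t ^ n` with `n ≥ 2` (as `w = O(s ^ k)`), truncating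
  -- the powers of `T`, and the derivative terms that no recurrence absorbs. In the linear term,
  -- `lam * κ = μ`, so `w` produces exactly the Hardy term `μ / r ^ p`.
  have E1 : (fun r => auxF p (c 0) (t r) - ∑ n ∈ Finset.range (k + 1), a n * t r ^ n)
      =O[atTop] fun r => s r ^ (k + 1) :=
    ((auxF_sub_taylor_isBigO hc0 k).comp_tendsto ht0).trans (hts.pow (k + 1))
  have E2 : ∀ n, (fun r => t r ^ (n + 1) - T r ^ (n + 1)) =O[atTop] fun r => s r ^ n * w r := by
    intro n
    induction n with
    | zero =>
      refine (isBigO_refl w atTop).neg_left.congr (fun r => ?_) fun r => by simp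
      simp [ht]
    | succ n ih =>
      have h1 : (fun r => t r ^ (n + 1) * w r) =O[atTop] fun r => s r ^ (n + 1) * w r :=
        (hts.pow (n + 1)).mul (isBigO_refl w _)
      have h2 : (fun r => T r * (t r ^ (n + 1) - T r ^ (n + 1))) =O[atTop]
          fun r => s r ^ (n + 1) * w r :=
        (hTs.mul ih).congr_right fun r => by ring
      refine (h2.sub h1).congr_left fun r => ?_
      have : w r = T r - t r := by simp [ht]
      rw [this]
      ring
  have E2' : ∀ n ∈ Finset.Icc 2 k, (fun r => a n * (t r ^ n - T r ^ n)) =O[atTop]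
      fun r => s r ^ (k + 1) := by
    intro n hn
    refine IsBigO.const_mul_left ?_ _
    obtain ⟨n, rfl⟩ : ∃ l, n = l + 1 := ⟨n - 1, by have := (Finset.mem_Icc.1 hn).1; omega⟩
    refine (E2 n).trans (hmulw ?_)
    have : 1 ≤ n := by have := (Finset.mem_Icc.1 hn).1; omega
    simpa using hpow_le this
  have E3 : ∀ n ∈ Finset.Icc 2 k, (fun r => a n * (T r ^ n
      - ∑ i ∈ Finset.range (k + 1), compSum c n i * s r ^ i)) =O[atTop]
      fun r => s r ^ (k + 1) := fun n _ =>
    ((pow_sum_sub_compSum_isBigO c k n).comp_tendsto hs0).const_mul_left _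
  have E4 : (fun r => ((N : ℝ) - 1) * (s r * w r) - κ * p * (s r * (r ^ p)⁻¹)
      - ((N : ℝ) - 1 - k) * c k * s r ^ (k + 1)) =O[atTop] fun r => s r ^ (k + 1) := by
    refine ((IsBigO.const_mul_left (hmulw (isBigO_refl s _)) _).sub ?_).sub
      ((isBigO_refl _ _).const_mul_left _)
    refine ((hmulw (isBigO_refl s _)).const_mul_left p).congr_left fun r => ?_
    simp only [hw]
    ring
  have key := (E1.add ((IsBigO.fun_sum E2').add (IsBigO.fun_sum E3))).add E4
  refine (key.congr' ?_ ?_)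
  · filter_upwards [eventually_gt_atTop 0] with r hr
    have hrange : ∀ g : ℕ → ℝ, ∑ i ∈ Finset.range (k + 1), g i
        = g 0 + ∑ i ∈ Finset.Icc 1 k, g i := by
      intro g
      rw [Finset.range_eq_Ico, Finset.sum_eq_sum_Ico_succ_bot (by omega)]
      rfl
    have hIcc : ∀ g : ℕ → ℝ, ∑ i ∈ Finset.Icc 1 k, g i = g 1 + ∑ i ∈ Finset.Icc 2 k, g i := by
      intro g
      rw [← Finset.Ico_add_one_right_eq_Icc, Finset.sum_eq_sum_Ico_succ_bot (by omega)]
      rfl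
    have hP : expansion p μ m k c r = c 0 + t r := by
      rw [expansion, hrange]
      simp only [ht, hT, hw, hκ, hs, pow_zero, inv_pow, div_eq_mul_inv, mul_inv]
      ring
    have hP' : expansionDeriv p μ m k c r = -∑ i ∈ Finset.Icc 1 k, i * c i * s r ^ (i + 1)
        + κ * p * (s r * (r ^ p)⁻¹) := by
      rw [expansionDeriv, hrange, Real.rpow_add_one hr.ne']
      simp only [hκ, hs, inv_pow, div_eq_mul_inv, mul_inv]
      field_simp
      simp only [CharP.cast_eq_zero, zero_mul, zero_add]
      ring
    have hF : (p - 1) * expansion p μ m k c r ^ (p / (p - 1)) = auxF p (c 0) (t r) := by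
      rw [hP, auxF]
    have hrec : ∑ n ∈ Finset.Icc 2 k, a n * ∑ i ∈ Finset.range (k + 1), compSum c n i * s r ^ i
        = ∑ i ∈ Finset.Icc 1 k, (((N : ℝ) - i) * c (i - 1) - lam * c i) * s r ^ i := by
      have : ∀ n ∈ Finset.Icc 2 k, a n * ∑ i ∈ Finset.range (k + 1), compSum c n i * s r ^ i
          = ∑ i ∈ Finset.Icc 1 k, a n * compSum c n i * s r ^ i := by
        intro n hn
        rw [hrange, compSum_eq_zero_of_lt c (by have := (Finset.mem_Icc.1 hn).1; omega), zero_mul,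
          zero_add, Finset.mul_sum]
        exact Finset.sum_congr rfl fun i _ => by ring
      rw [Finset.sum_congr rfl this, Finset.sum_comm]
      refine Finset.sum_congr rfl fun i hi => ?_
      rw [← Finset.sum_mul, hc.recurrence hp hm (Finset.mem_Icc.1 hi).1 (Finset.mem_Icc.1 hi).2]
    have hshift := sum_Icc_add_zero_eq (fun i => ((N : ℝ) - 1 - i) * c i * s r ^ (i + 1)) k
    have hshift' : ∑ i ∈ Finset.Icc 1 k, ((N : ℝ) - 1 - (i - 1 : ℕ)) * c (i - 1) * s r ^ (i - 1 + 1)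
        = ∑ i ∈ Finset.Icc 1 k, ((N : ℝ) - i) * c (i - 1) * s r ^ i := by
      refine Finset.sum_congr rfl fun i hi => ?_
      have h1 := (Finset.mem_Icc.1 hi).1
      rw [Nat.sub_add_cancel h1, Nat.cast_sub h1]
      push_cast
      ring
    rw [hshift'] at hshift
    have hsplit : ∑ i ∈ Finset.Icc 1 k, (((N : ℝ) - i) * c (i - 1) - lam * c i) * s r ^ i
        = ∑ i ∈ Finset.Icc 1 k, ((N : ℝ) - i) * c (i - 1) * s r ^ i - lam * T r := by
      simp only [hT, Finset.mul_sum, ← Finset.sum_sub_distrib]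
      exact Finset.sum_congr rfl fun i _ => by ring
    have hsplit' : ∑ i ∈ Finset.Icc 1 k, ((N : ℝ) - 1 - i) * c i * s r ^ (i + 1)
        = ((N : ℝ) - 1) * s r * T r - ∑ i ∈ Finset.Icc 1 k, i * c i * s r ^ (i + 1) := by
      simp only [hT, Finset.mul_sum, ← Finset.sum_sub_distrib]
      exact Finset.sum_congr rfl fun i _ => by ring
    have hμ : μ / r ^ p = lam * w r := by
      simp only [hw]
      rw [← hlamκ]
      ring
    rw [hF, hP, hP', hμ, hrange, hIcc, ha0, ha1]
    simp only [mul_sub, Finset.sum_sub_distrib, hrec]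
    rw [hsplit]
    rw [hsplit'] at hshift
    simp only [zero_add, pow_one, Nat.cast_zero, sub_zero] at hshift
    have hsr : ((N : ℝ) - 1) / r = ((N : ℝ) - 1) * s r := by simp [hs, div_eq_mul_inv]
    have htr : t r = T r - w r := rfl
    rw [hsr]
    simp only [pow_zero, pow_one, htr]
    linear_combination hshift
  · exact Eventually.of_forall fun r => by simp [hs]

/-! ### Differential inequalities on a half-line -/

/-- A function that increases at speed at least `δ` whenever it is at least `B` escapes to
infinity once it has reached `B`. -/
lemma tendsto_atTop_of_escape {y y' : ℝ → ℝ} {a B δ : ℝ} (hδ : 0 < δ)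
    (hy : ∀ r, a ≤ r → HasDerivAt y (y' r) r) (ha : B ≤ y a)
    (h : ∀ r, a ≤ r → B ≤ y r → δ ≤ y' r) :
    (∀ r, a ≤ r → B ≤ y r) ∧ Tendsto y atTop atTop := by
  have key : ∀ r, a ≤ r → B + δ / 2 * (r - a) ≤ y r := by
    intro r hr
    refine image_le_of_deriv_right_lt_deriv_boundary' (f := fun r => B + δ / 2 * (r - a))
      (f' := fun _ => δ / 2) (a := a) (b := r) (B := y) (B' := y') (by fun_prop) ?_ (by simpa)
      (fun x hx => (hy x hx.1).continuousAt.continuousWithinAt)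
      (fun x hx => (hy x hx.1).hasDerivWithinAt) ?_ ⟨hr, le_rfl⟩
    · intro x _
      have := (((hasDerivAt_id x).sub_const a).const_mul (δ / 2)).const_add B
      simpa using this.hasDerivWithinAt
    · intro x hx hxy
      have : B ≤ y x := by
        rw [← hxy]
        have : 0 ≤ δ / 2 * (x - a) := mul_nonneg (by linarith) (by linarith [hx.1])
        linarith
      linarith [h x hx.1 this]
  refine ⟨fun r hr => ?_, ?_⟩
  · have : 0 ≤ δ / 2 * (r - a) := mul_nonneg (by linarith) (by linarith)
    linarith [key r hr]
  · refine tendsto_atTop_mono' atTop ((eventually_ge_atTop a).mono key) ?_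
    refine tendsto_atTop_add_const_left _ _ (Tendsto.const_mul_atTop (by linarith) ?_)
    exact tendsto_atTop_add_const_right _ _ tendsto_id

/-- For a repelling linear equation with a small source, the only solutions that stay small
are as small as the source. -/
lemma le_of_repelling {y y' b : ℝ → ℝ} {a R : ℝ} (ha : 0 < a)
    (hy : ∀ r, R ≤ r → HasDerivAt y (y' r) r) (hlim : Tendsto y atTop (𝓝 0))
    (hb : ∀ r, R ≤ r → 0 < b r) (hanti : ∀ r s, R ≤ r → r ≤ s → b s ≤ b r)
    (h : ∀ r, R ≤ r → 0 < y r → a * y r - b r ≤ y' r) {r : ℝ} (hr : R ≤ r) :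
    y r ≤ 2 / a * b r := by
  by_contra hcon
  push Not at hcon
  have hbr := hb r hr
  have hyr : 0 < y r := lt_trans (by positivity) hcon
  have h2 : b r < a * y r / 2 := by
    rw [div_mul_eq_mul_div, div_lt_iff₀ ha] at hcon
    linarith
  refine not_tendsto_atTop_of_tendsto_nhds hlim (tendsto_atTop_of_escape (a := r) (B := y r)
    (δ := a * y r / 2) (by positivity) (fun s hs => hy s (hr.trans hs)) le_rfl ?_).2
  intro s hs hys
  have h1 := h s (hr.trans hs) (hyr.trans_le hys)
  have h3 := hanti r s hr hs
  have h4 : a * y r ≤ a * y s := by gcongr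
  linarith

/-! ### Positive solutions of the Riccati equation -/

/-- The tangent inequality for the convex function `x ↦ x ^ α`. -/
lemma rpow_sub_rpow_ge {α x y : ℝ} (hα : 1 ≤ α) (hx : 0 ≤ x) (hy : 0 < y) :
    α * y ^ (α - 1) * (x - y) ≤ x ^ α - y ^ α := by
  have h := one_add_mul_self_le_rpow_one_add (s := (x - y) / y)
    (by rw [le_div_iff₀ hy]; linarith) hα
  have e : 1 + (x - y) / y = x / y := by field_simp; ring
  rw [e, Real.div_rpow hx hy.le, le_div_iff₀ (by positivity)] at h
  rw [Real.rpow_sub_one hy.ne']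
  have : α * (y ^ α / y) * (x - y) = (1 + α * ((x - y) / y)) * y ^ α - y ^ α := by ring
  linarith

/-- Positive global solutions of a perturbed autonomous Riccati equation converge to the
(repelling) equilibrium: above it they blow up in finite time, below it they become negative. -/
lemma riccati_tendsto {α β m c₀ R : ℝ} {h h' ε₁ ε₂ : ℝ → ℝ} (hα : 1 < α) (hβ : 0 < β)
    (hc : 0 < c₀) (hcm : β * c₀ ^ α = m)
    (hε₁ : Tendsto ε₁ atTop (𝓝 0)) (hε₂ : Tendsto ε₂ atTop (𝓝 0))
    (hpos : ∀ r, R ≤ r → 0 < h r) (hd : ∀ r, R ≤ r → HasDerivAt h (h' r) r)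
    (heq : ∀ r, R ≤ r → h' r = β * h r ^ α - m + ε₁ r * h r + ε₂ r) :
    Tendsto h atTop (𝓝 c₀) := by
  have small : ∀ {ε : ℝ → ℝ} (_ : Tendsto ε atTop (𝓝 0)) {δ : ℝ} (_ : 0 < δ),
      ∀ᶠ r in atTop, |ε r| ≤ δ := by
    intro ε hε δ hδ
    filter_upwards [(Metric.tendsto_nhds.1 hε) δ hδ] with r hr
    rw [Real.dist_eq, sub_zero] at hr
    exact hr.le
  refine tendsto_order.2 ⟨fun b hb => ?_, fun b hb => ?_⟩
  · rcases le_or_gt b 0 with hb0 | hb0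
    · filter_upwards [eventually_ge_atTop R] with r hr using hb0.trans_lt (hpos r hr)
    set η := m - β * b ^ α
    have hη : 0 < η := by
      have : b ^ α < c₀ ^ α := Real.rpow_lt_rpow hb0.le hb (by linarith)
      have : β * b ^ α < β * c₀ ^ α := by gcongr
      simp only [η]
      linarith
    obtain ⟨R', hR'⟩ := eventually_atTop.1 ((small hε₁ (δ := η / 4 / b) (by positivity)).and
      ((small hε₂ (δ := η / 4) (by positivity)).and (eventually_ge_atTop R)))
    refine eventually_atTop.2 ⟨R', fun r hr => ?_⟩
    by_contra hcon
    push Not at hcon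
    have hR : ∀ s, r ≤ s → R ≤ s := fun s hs => (hR' s (hr.trans hs)).2.2
    have esc := (tendsto_atTop_of_escape (y := fun s => -h s) (y' := fun s => -h' s) (a := r)
      (B := -b) (δ := η / 2) (by positivity) (fun s hs => (hd s (hR s hs)).neg) (by simpa) ?_).2
    · obtain ⟨s, hs⟩ := ((esc.eventually_ge_atTop 0).and (eventually_ge_atTop r)).exists
      linarith [hs.1, hpos s (hR s hs.2)]
    · intro s hs hsb
      obtain ⟨h1, h2, h3⟩ := hR' s (hr.trans hs)
      have hp := hpos s h3
      have hle : h s ≤ b := by linarith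
      rw [heq s h3]
      have e1 : h s ^ α ≤ b ^ α := Real.rpow_le_rpow hp.le hle (by linarith)
      have e1' : β * h s ^ α ≤ β * b ^ α := by gcongr
      have e2 : ε₁ s * h s ≤ η / 4 := by
        calc ε₁ s * h s ≤ (η / 4 / b) * b :=
              mul_le_mul ((le_abs_self _).trans h1) hle hp.le (by positivity)
          _ = η / 4 := by field_simp
      have e3 := (le_abs_self _).trans h2
      have : β * b ^ α = m - η := by simp [η]
      linarith
  · have hb0 : 0 < b := hc.trans hb
    set θ := β - m / b ^ α
    have hbα : 0 < b ^ α := by positivity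
    have hθ : 0 < θ := by
      have : c₀ ^ α < b ^ α := Real.rpow_lt_rpow hc.le hb (by linarith)
      have : β * c₀ ^ α < β * b ^ α := by gcongr
      simp only [θ, sub_pos]
      rw [div_lt_iff₀ hbα]
      linarith
    have hm : 0 < m := by rw [← hcm]; positivity
    obtain ⟨R', hR'⟩ := eventually_atTop.1
      ((small hε₁ (δ := θ / 4 * b ^ (α - 1)) (by positivity)).and
      ((small hε₂ (δ := θ / 4 * b ^ α) (by positivity)).and (eventually_ge_atTop R)))
    refine eventually_atTop.2 ⟨R', fun r hr => ?_⟩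
    by_contra hcon
    push Not at hcon
    have hR : ∀ s, r ≤ s → R ≤ s := fun s hs => (hR' s (hr.trans hs)).2.2
    have grow : ∀ s, r ≤ s → b ≤ h s → θ / 2 * h s ^ α ≤ h' s := by
      intro s hs hsb
      obtain ⟨h1, h2, h3⟩ := hR' s (hr.trans hs)
      have hp := hpos s h3
      have e0 : b ^ α ≤ h s ^ α := Real.rpow_le_rpow hb0.le hsb (by linarith)
      have e0' : b ^ (α - 1) ≤ h s ^ (α - 1) := Real.rpow_le_rpow hb0.le hsb (by linarith)
      have em : m ≤ m / b ^ α * h s ^ α := by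
        rw [div_mul_eq_mul_div, le_div_iff₀ hbα]
        gcongr
      have e1 : -(θ / 4 * h s ^ α) ≤ ε₁ s * h s := by
        have : |ε₁ s * h s| ≤ θ / 4 * h s ^ α := by
          rw [abs_mul, abs_of_pos hp]
          calc |ε₁ s| * h s ≤ (θ / 4 * b ^ (α - 1)) * h s := by gcongr
            _ ≤ (θ / 4 * h s ^ (α - 1)) * h s := by gcongr
            _ = θ / 4 * h s ^ α := by
              rw [mul_assoc, ← Real.rpow_add_one hp.ne']
              congr 2
              ring
        linarith [neg_abs_le (ε₁ s * h s)]
      have e2 : -(θ / 4 * h s ^ α) ≤ ε₂ s := by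
        have : |ε₂ s| ≤ θ / 4 * h s ^ α := h2.trans (by gcongr)
        linarith [neg_abs_le (ε₂ s)]
      rw [heq s h3]
      have : θ * h s ^ α = β * h s ^ α - m / b ^ α * h s ^ α := by simp only [θ]; ring
      linarith
    have hge := (tendsto_atTop_of_escape (y := h) (y' := h') (a := r) (B := b)
      (δ := θ / 2 * b ^ α) (by positivity) (fun s hs => hd s (hR s hs)) hcon (fun s hs hsb =>
        le_trans (by gcongr) (grow s hs hsb))).1
    -- `h ^ (1 - α)` decreases at least at unit speed, so it would vanish in finite time
    have esc := (tendsto_atTop_of_escape (y := fun s => -(h s ^ (1 - α)))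
      (y' := fun s => -(h' s * (1 - α) * h s ^ (1 - α - 1))) (a := r) (B := -(h r ^ (1 - α)))
      (δ := (α - 1) * (θ / 2)) (mul_pos (by linarith) (by positivity))
      (fun s hs => ((hd s (hR s hs)).rpow_const (Or.inl (hpos s (hR s hs)).ne')).neg) le_rfl ?_).2
    · obtain ⟨s, hs⟩ := ((esc.eventually_ge_atTop 0).and (eventually_ge_atTop r)).exists
      have := Real.rpow_pos_of_pos (hpos s (hR s hs.2)) (1 - α)
      linarith [hs.1]
    · intro s hs _
      have hp := hpos s (hR s hs)
      have g := grow s hs (hge s hs)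
      rw [show 1 - α - 1 = -α by ring, Real.rpow_neg hp.le]
      have hα' : 0 < α - 1 := by linarith
      have hpa : 0 < h s ^ α := by positivity
      calc (α - 1) * (θ / 2) = (α - 1) * (θ / 2 * h s ^ α) * (h s ^ α)⁻¹ := by field_simp
        _ ≤ (α - 1) * h' s * (h s ^ α)⁻¹ := by gcongr
        _ = _ := by ring

/-- Two functions converging to the same positive limit, of which one solves the Riccati equation
`h' = β h ^ α - ν h / r - m + μ / r ^ p` and the other one too, up to errors `O(r ^ (-l))`, differ
by `O(r ^ (-l))`: the linearized equation is repelling. -/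
lemma riccati_compare {α β ν c₀ : ℝ} {l : ℕ} {h h' P P' : ℝ → ℝ} {V : ℝ → ℝ} (hα : 1 < α)
    (hβ : 0 < β) (hc : 0 < c₀) (hh : Tendsto h atTop (𝓝 c₀)) (hP : Tendsto P atTop (𝓝 c₀))
    (hd : ∀ᶠ r in atTop, HasDerivAt h (h' r) r) (hPd : ∀ᶠ r in atTop, HasDerivAt P (P' r) r)
    (heq : (fun r => h' r - (β * h r ^ α - ν / r * h r + V r)) =O[atTop] fun r => 1 / r ^ l)
    (hPeq : (fun r => β * P r ^ α - ν / r * P r + V r - P' r) =O[atTop] fun r => 1 / r ^ l) :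
    (fun r => h r - P r) =O[atTop] fun r => 1 / r ^ l := by
  obtain ⟨C, hC0, hC⟩ := (heq.add hPeq).exists_pos
  rw [IsBigOWith] at hC
  set L := β * (α * (c₀ / 2) ^ (α - 1)) with hL
  have hL0 : 0 < L := by positivity
  have hν : Tendsto (fun r : ℝ => ν / r) atTop (𝓝 0) := tendsto_const_nhds.div_atTop tendsto_id
  have hhalf : c₀ / 2 < c₀ := by linarith
  obtain ⟨R, hR⟩ := eventually_atTop.1 (hC.and (hd.and (hPd.and ((hh.eventually_const_le hhalf).and
    ((hP.eventually_const_le hhalf).and ((hν.eventually_le_const (half_pos hL0)).and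
      (eventually_ge_atTop 1)))))))
  have lower : ∀ x y : ℝ, c₀ / 2 ≤ x → c₀ / 2 ≤ y → 0 < x - y →
      L * (x - y) ≤ β * (x ^ α - y ^ α) := by
    intro x y hx hy hxy
    have hy0 : 0 < y := by linarith
    have h1 := rpow_sub_rpow_ge hα.le (by linarith : 0 ≤ x) hy0
    have h2 : (c₀ / 2) ^ (α - 1) ≤ y ^ (α - 1) := Real.rpow_le_rpow (by positivity) hy (by linarith)
    rw [hL, mul_assoc]
    refine mul_le_mul_of_nonneg_left (le_trans ?_ h1) hβ.le
    gcongr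
  have hlim : Tendsto (fun r => h r - P r) atTop (𝓝 0) := by simpa using hh.sub hP
  have hb : ∀ r, max R 1 ≤ r → 0 < C * (1 / r ^ l) := by
    intro r hr
    have : 0 < r := by linarith [le_max_right R 1]
    positivity
  have hanti : ∀ r s, max R 1 ≤ r → r ≤ s → C * (1 / s ^ l) ≤ C * (1 / r ^ l) := by
    intro r s hr hs
    have : 0 < r := by linarith [le_max_right R 1]
    gcongr
  have bound : ∀ r, max R 1 ≤ r →
      |h' r - P' r - (β * (h r ^ α - P r ^ α) - ν / r * (h r - P r))| ≤ C * (1 / r ^ l) := by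
    intro r hr
    have h1 := (hR r ((le_max_left _ _).trans hr)).1
    have : 0 < r := by linarith [le_max_right R 1]
    rw [Real.norm_of_nonneg (by positivity : (0 : ℝ) ≤ 1 / r ^ l), Real.norm_eq_abs] at h1
    refine le_trans (le_of_eq ?_) h1
    congr 1
    ring
  refine IsBigO.of_bound (2 / (L / 2) * C) ?_
  filter_upwards [eventually_ge_atTop (max R 1)] with r hr
  have hr0 : 0 < r := by linarith [le_max_right R 1]
  rw [Real.norm_of_nonneg (by positivity : (0 : ℝ) ≤ 1 / r ^ l), Real.norm_eq_abs, mul_assoc]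
  refine abs_le.2 ⟨?_, ?_⟩
  · have := le_of_repelling (y := fun r => P r - h r) (y' := fun r => P' r - h' r) (half_pos hL0)
      (R := max R 1) (fun s hs => ?_) (by simpa using hlim.neg) hb hanti ?_ hr
    · linarith
    · obtain ⟨-, h2, h3, -⟩ := hR s ((le_max_left _ _).trans hs)
      exact h3.sub h2
    · intro s hs hpos
      obtain ⟨-, -, -, h4, h5, h6, -⟩ := hR s ((le_max_left _ _).trans hs)
      have e1 := lower _ _ h5 h4 hpos
      have e2 := (abs_le.1 (bound s hs)).2
      have e3 : ν / s * (P s - h s) ≤ L / 2 * (P s - h s) := by gcongr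
      linarith
  · refine le_of_repelling (y := fun r => h r - P r) (y' := fun r => h' r - P' r) (half_pos hL0)
      (R := max R 1) (fun s hs => ?_) hlim hb hanti ?_ hr
    · obtain ⟨-, h2, h3, -⟩ := hR s ((le_max_left _ _).trans hs)
      exact h2.sub h3
    · intro s hs hpos
      obtain ⟨-, -, -, h4, h5, h6, -⟩ := hR s ((le_max_left _ _).trans hs)
      have e1 := lower _ _ h4 h5 hpos
      have e2 := (abs_le.1 (bound s hs)).1
      have e3 : ν / s * (h s - P s) ≤ L / 2 * (h s - P s) := by gcongr
      linarith

/-! ### The nonlinearity near zero -/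

lemma abs_rpow_mul_self {p : ℝ} (hp : 1 < p) (x : ℝ) :
    |(|x| ^ (p - 2) * x)| = |x| ^ (p - 1) := by
  rcases eq_or_ne x 0 with rfl | hx
  · simp [Real.zero_rpow (by linarith : p - 1 ≠ 0)]
  · have : 0 < |x| := abs_pos.2 hx
    rw [abs_mul, abs_of_pos (Real.rpow_pos_of_pos this _), ← Real.rpow_add_one this.ne']
    congr 1
    ring

lemma rpow_mul_self_of_pos {p x : ℝ} (hx : 0 < x) : |x| ^ (p - 2) * x = x ^ (p - 1) := by
  rw [abs_of_pos hx, ← Real.rpow_add_one hx.ne']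
  congr 1
  ring

lemma GrowthAtZero.exists_bound {f : ℝ → ℝ} {q A : ℝ} (hf : Continuous f) (hq : 1 < q)
    (h : GrowthAtZero f q A) :
    ∃ B t₀ : ℝ, 0 ≤ B ∧ 0 < t₀ ∧ ∀ t, 0 ≤ t → t ≤ t₀ → |f t| ≤ B * t ^ (q - 1) := by
  have h1 : limsup (fun t : ℝ => ((|f t| / |t| ^ (q - 1) : ℝ) : EReal)) (𝓝[≠] (0 : ℝ))
      < ((|A| + 1 : ℝ) : EReal) :=
    lt_of_le_of_lt h (EReal.coe_lt_coe_iff.2 (by linarith [le_abs_self A]))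
  have h2 := eventually_lt_of_limsup_lt h1
  rw [eventually_nhdsWithin_iff, Metric.eventually_nhds_iff] at h2
  obtain ⟨ε, hε, h2⟩ := h2
  have bound : ∀ t, 0 < t → t ≤ ε / 2 → |f t| ≤ (|A| + 1) * t ^ (q - 1) := by
    intro t ht hte
    have h3 := h2 (y := t) (by rw [Real.dist_eq, sub_zero, abs_of_pos ht]; linarith) ht.ne'
    rw [EReal.coe_lt_coe_iff, abs_of_pos ht, div_lt_iff₀ (by positivity)] at h3
    exact h3.le
  refine ⟨|A| + 1, ε / 2, by positivity, by positivity, fun t ht hte => ?_⟩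
  rcases ht.lt_or_eq with ht | rfl
  · exact bound t ht hte
  · have hl : Tendsto (fun t => |f t|) (𝓝[>] 0) (𝓝 |f 0|) :=
      (hf.abs.tendsto 0).mono_left nhdsWithin_le_nhds
    have hr : Tendsto (fun t : ℝ => (|A| + 1) * t ^ (q - 1)) (𝓝[>] 0)
        (𝓝 ((|A| + 1) * (0 : ℝ) ^ (q - 1))) :=
      ((Real.continuousAt_rpow_const 0 (q - 1) (Or.inr (by linarith))).tendsto.mono_left
        nhdsWithin_le_nhds).const_mul _
    refine le_of_tendsto_of_tendsto hl hr ?_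
    filter_upwards [Ioc_mem_nhdsGT (half_pos hε)] with t ht using bound t ht.1 ht.2

/-! ### Solutions of the radial equation -/

/-- `v` is a `C¹` solution on `(0, ∞)`, with derivative `w`, of the radial equation
`(r ^ (N - 1) |v'| ^ (p - 2) v')' = r ^ (N - 1) ((m - μ / r ^ p) |v| ^ (p - 2) v - f v)`. -/
structure IsRadialSolution (N : ℕ) (p μ m : ℝ) (f : ℝ → ℝ) (v w : ℝ → ℝ) : Prop where
  hasDerivAt : ∀ r, 0 < r → HasDerivAt v (w r) r
  continuousOn_deriv : ContinuousOn w (Set.Ioi 0)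
  hasDerivAt_flux : ∀ r, 0 < r → HasDerivAt (fun r => r ^ (N - 1) * (|w r| ^ (p - 2) * w r))
    (r ^ (N - 1) * ((m - μ / r ^ p) * (|v r| ^ (p - 2) * v r) - f (v r))) r

namespace IsRadialSolution

variable {N : ℕ} {p μ m q : ℝ} {f v w : ℝ → ℝ}

lemma continuousOn (hv : IsRadialSolution N p μ m f v w) : ContinuousOn v (Set.Ioi 0) :=
  fun r hr => (hv.hasDerivAt r hr).continuousAt.continuousWithinAt

/-- Uniqueness for the Cauchy problem with zero data, to the right of a zero of a nonnegative
solution. -/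
lemma eq_zero_right (hv : IsRadialSolution N p μ m f v w) (hp : 1 < p) (hμ : 0 ≤ μ) (hm : 0 < m)
    (hq : p ≤ q) {B t₀ : ℝ} (hB : 0 ≤ B) (ht₀ : 0 < t₀)
    (hfB : ∀ t, 0 ≤ t → t ≤ t₀ → |f t| ≤ B * t ^ (q - 1))
    (hnn : ∀ r, 0 < r → 0 ≤ v r) {r₀ : ℝ} (hr₀ : 0 < r₀) (h0 : v r₀ = 0) :
    ∃ δ > 0, ∀ r ∈ Set.Icc r₀ (r₀ + δ), v r = 0 := by
  have hp1 : 0 < p - 1 := by linarith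
  have hw0 : w r₀ = 0 := by
    refine IsLocalMin.hasDerivAt_eq_zero ?_ (hv.hasDerivAt r₀ hr₀)
    filter_upwards [Ioi_mem_nhds hr₀] with r hr
    rw [h0]
    exact hnn r hr
  -- near `r₀` the right-hand side of the equation is at most `K v ^ (p - 1)`
  set K : ℝ := (r₀ + 1) ^ (N - 1) * (m + μ / r₀ ^ p + B) with hK
  have hK0 : 0 < K := by positivity
  have hsmall : ∀ᶠ r in 𝓝 r₀, v r < min t₀ 1 := by
    have := (hv.hasDerivAt r₀ hr₀).continuousAt.tendsto
    rw [h0] at this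
    exact this.eventually_lt_const (by positivity)
  obtain ⟨δ₁, hδ₁, hδ₁v⟩ := Metric.eventually_nhds_iff.1 hsmall
  set δ : ℝ := min (min (δ₁ / 2) 1) (r₀ ^ (N - 1) * (1 / 2) ^ (p - 1) / K) with hδ
  have hδ0 : 0 < δ := by positivity
  have hδ1 : δ ≤ 1 := (min_le_left _ _).trans (min_le_right _ _)
  have hδ2 : δ ≤ δ₁ / 2 := (min_le_left _ _).trans (min_le_left _ _)
  have hδ3 : K * δ ≤ r₀ ^ (N - 1) * (1 / 2) ^ (p - 1) := by
    have : δ ≤ r₀ ^ (N - 1) * (1 / 2) ^ (p - 1) / K := min_le_right _ _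
    rw [le_div_iff₀ hK0] at this
    linarith
  refine ⟨δ, hδ0, ?_⟩
  have hpos : ∀ r ∈ Set.Icc r₀ (r₀ + δ), 0 < r := fun r hr => hr₀.trans_le hr.1
  obtain ⟨r₁, hr₁, hmax⟩ := isCompact_Icc.exists_isMaxOn
    (Set.nonempty_Icc.2 (by linarith : r₀ ≤ r₀ + δ)) (hv.continuousOn.mono hpos)
  set M := v r₁ with hM
  have hM0 : 0 ≤ M := hnn r₁ (hpos r₁ hr₁)
  have hflux : ∀ r ∈ Set.Icc r₀ (r₀ + δ),
      |r ^ (N - 1) * ((m - μ / r ^ p) * (|v r| ^ (p - 2) * v r) - f (v r))| ≤ K * M ^ (p - 1) := by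
    intro r hr
    have hr0 := hpos r hr
    have hvr := hnn r hr0
    have hvt : v r < min t₀ 1 := hδ₁v (by
      rw [Real.dist_eq, abs_of_nonneg (by linarith [hr.1])]
      linarith [hr.2])
    have h1 : |f (v r)| ≤ B * v r ^ (p - 1) := by
      refine (hfB _ hvr (hvt.le.trans (min_le_left _ _))).trans ?_
      gcongr B * ?_
      exact Real.rpow_le_rpow_of_exponent_ge' hvr (hvt.le.trans (min_le_right _ _)) hp1.le
        (by linarith)
    have h2 : |m - μ / r ^ p| ≤ m + μ / r₀ ^ p := by
      refine (abs_sub _ _).trans ?_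
      rw [abs_of_pos hm, abs_of_nonneg (by positivity)]
      gcongr
      exact hr.1
    have h3 : v r ^ (p - 1) ≤ M ^ (p - 1) := Real.rpow_le_rpow hvr (hmax hr) hp1.le
    rw [abs_mul, abs_of_pos (by positivity : 0 < r ^ (N - 1)), hK, mul_assoc]
    gcongr ?_ * ?_
    · gcongr
      linarith [hr.2]
    · refine (abs_sub _ _).trans ?_
      rw [abs_mul, abs_rpow_mul_self hp, abs_of_nonneg hvr]
      calc |m - μ / r ^ p| * v r ^ (p - 1) + |f (v r)|
          ≤ (m + μ / r₀ ^ p) * v r ^ (p - 1) + B * v r ^ (p - 1) := by gcongr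
        _ = (m + μ / r₀ ^ p + B) * v r ^ (p - 1) := by ring
        _ ≤ _ := by gcongr
  have hw : ∀ r ∈ Set.Icc r₀ (r₀ + δ), |w r| ≤ M / 2 := by
    intro r hr
    have hr0 := hpos r hr
    have h1 := norm_image_sub_le_of_norm_deriv_le_segment' (a := r₀) (b := r₀ + δ)
      (fun x hx => (hv.hasDerivAt_flux x (hpos x hx)).hasDerivWithinAt)
      (fun x hx => hflux x (Set.Ico_subset_Icc_self hx)) r hr
    rw [hw0, mul_zero, mul_zero, sub_zero, Real.norm_eq_abs, abs_mul, abs_rpow_mul_self hp,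
      abs_of_pos (by positivity : 0 < r ^ (N - 1))] at h1
    have h2 : r₀ ^ (N - 1) * |w r| ^ (p - 1) ≤ r₀ ^ (N - 1) * (M / 2) ^ (p - 1) := by
      calc r₀ ^ (N - 1) * |w r| ^ (p - 1) ≤ r ^ (N - 1) * |w r| ^ (p - 1) := by
            gcongr
            exact hr.1
        _ ≤ K * M ^ (p - 1) * (r - r₀) := h1
        _ ≤ K * M ^ (p - 1) * δ := by
          gcongr
          linarith [hr.2]
        _ = K * δ * M ^ (p - 1) := by ring
        _ ≤ r₀ ^ (N - 1) * (1 / 2) ^ (p - 1) * M ^ (p - 1) := by gcongr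
        _ = r₀ ^ (N - 1) * (M / 2) ^ (p - 1) := by
          rw [mul_assoc, ← Real.mul_rpow (by norm_num) hM0]
          congr 2
          ring
    have h3 := le_of_mul_le_mul_left h2 (by positivity)
    exact (Real.rpow_le_rpow_iff (abs_nonneg _) (by positivity) hp1).1 h3
  -- On an interval of length at most one, `v r₀ = 0` and `|w| ≤ M / 2` force `M ≤ M / 2`.
  have hMle : M ≤ M / 2 := by
    have h1 := norm_image_sub_le_of_norm_deriv_le_segment' (a := r₀) (b := r₀ + δ)
      (fun x hx => (hv.hasDerivAt x (hpos x hx)).hasDerivWithinAt)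
      (fun x hx => hw x (Set.Ico_subset_Icc_self hx)) r₁ hr₁
    rw [h0, sub_zero, Real.norm_of_nonneg hM0] at h1
    refine h1.trans (mul_le_of_le_one_right (by positivity) ?_)
    linarith [hr₁.2]
  intro r hr
  exact le_antisymm ((hmax hr).trans (by linarith)) (hnn r (hpos r hr))

/-- The strong maximum principle. -/
lemma pos (hv : IsRadialSolution N p μ m f v w) (hp : 1 < p) (hμ : 0 ≤ μ) (hm : 0 < m)
    (hq : p ≤ q) {B t₀ : ℝ} (hB : 0 ≤ B) (ht₀ : 0 < t₀)
    (hfB : ∀ t, 0 ≤ t → t ≤ t₀ → |f t| ≤ B * t ^ (q - 1))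
    (hae : ∀ᵐ r ∂volume.restrict (Set.Ioi (0 : ℝ)), 0 < v r) : ∀ r, 0 < r → 0 < v r := by
  rw [ae_restrict_iff' measurableSet_Ioi] at hae
  have hdense : ∀ a b : ℝ, 0 < a → a < b → ∃ r ∈ Set.Ioo a b, 0 < v r := by
    intro a b ha hab
    by_contra hcon
    push Not at hcon
    have hsub : Set.Ioo a b ⊆ {r | ¬ (r ∈ Set.Ioi (0 : ℝ) → 0 < v r)} := by
      intro r hr
      simp only [Set.mem_ofPred_eq, Classical.not_imp, not_lt]
      exact ⟨ha.trans hr.1, hcon r hr⟩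
    have := measure_mono_null hsub (ae_iff.1 hae)
    rw [Real.volume_Ioo, ENNReal.ofReal_eq_zero] at this
    linarith
  have hnn : ∀ r, 0 < r → 0 ≤ v r := by
    intro r hr
    by_contra hcon
    push Not at hcon
    obtain ⟨ε, hε, hεv⟩ := Metric.eventually_nhds_iff.1
      ((hv.hasDerivAt r hr).continuousAt.eventually_lt_const hcon)
    obtain ⟨s, hs, hs'⟩ := hdense r (r + ε) hr (by linarith)
    have := hεv (y := s) (by
      rw [Real.dist_eq, abs_of_pos (by linarith [hs.1])]
      linarith [hs.2])
    linarith
  intro r hr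
  refine (hnn r hr).lt_of_ne' fun h0 => ?_
  obtain ⟨δ, hδ, h⟩ := hv.eq_zero_right hp hμ hm hq hB ht₀ hfB hnn hr h0
  obtain ⟨s, hs, hs'⟩ := hdense r (r + δ) hr (by linarith)
  exact hs'.ne' (h s ⟨hs.1.le, hs.2.le⟩)

lemma tendsto_zero (hv : IsRadialSolution N p μ m f v w) (hp : 1 < p)
    (hpos : ∀ r, 0 < r → 0 < v r)
    (hvi : IntegrableOn (fun r => r ^ (N - 1) * v r ^ p) (Set.Ioi 0))
    (hwi : IntegrableOn (fun r => r ^ (N - 1) * |w r| ^ p) (Set.Ioi 0)) :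
    Tendsto v atTop (𝓝 0) := by
  have hp0 : 0 < p := by linarith
  have hsub : Set.Ioi (1 : ℝ) ⊆ Set.Ioi 0 := Set.Ioi_subset_Ioi zero_le_one
  have cv := hv.continuousOn.mono hsub
  have cw := hv.continuousOn_deriv.mono hsub
  have hne : ∀ r ∈ Set.Ioi (1 : ℝ), v r ≠ 0 := fun r hr => (hpos r (hsub hr)).ne'
  have dom : ∀ {g : ℝ → ℝ}, ContinuousOn g (Set.Ioi 1) → (∀ r ∈ Set.Ioi (1 : ℝ), 0 ≤ g r) →
      IntegrableOn (fun r => r ^ (N - 1) * g r) (Set.Ioi 0) → IntegrableOn g (Set.Ioi 1) := by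
    intro g hg hg0 hi
    refine Integrable.mono' (hi.mono_set hsub) (hg.aestronglyMeasurable measurableSet_Ioi) ?_
    refine (ae_restrict_iff' measurableSet_Ioi).2 (Eventually.of_forall fun r hr => ?_)
    rw [Real.norm_of_nonneg (hg0 r hr)]
    exact le_mul_of_one_le_left (hg0 r hr) (one_le_pow₀ (le_of_lt hr))
  have iv : IntegrableOn (fun r => v r ^ p) (Set.Ioi 1) :=
    dom (cv.rpow_const fun r hr => Or.inl (hne r hr))
      (fun r hr => Real.rpow_nonneg (hpos r (hsub hr)).le _) hvi
  have iw : IntegrableOn (fun r => |w r| ^ p) (Set.Ioi 1) :=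
    dom (cw.abs.rpow_const fun r _ => Or.inr hp0.le)
      (fun r _ => Real.rpow_nonneg (abs_nonneg _) _) hwi
  have key := tendsto_zero_of_hasDerivAt_of_integrableOn_Ioi (f := fun r => v r ^ p)
    (f' := fun r => w r * p * v r ^ (p - 1)) (a := 1)
    (fun r hr => (hv.hasDerivAt r (hsub hr)).rpow_const (Or.inl (hne r hr))) ?_ iv
  · have h2 := key.rpow_const (p := 1 / p) (Or.inr (by positivity))
    rw [Real.zero_rpow (by positivity)] at h2
    refine h2.congr' ?_
    filter_upwards [eventually_gt_atTop 0] with r hr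
    rw [← Real.rpow_mul (hpos r hr).le, mul_one_div_cancel hp0.ne', Real.rpow_one]
  · refine Integrable.mono' ((iv.add iw).const_mul p) (ContinuousOn.aestronglyMeasurable
      ((cw.mul continuousOn_const).mul (cv.rpow_const fun r hr => Or.inl (hne r hr)))
      measurableSet_Ioi) ?_
    refine (ae_restrict_iff' measurableSet_Ioi).2 (Eventually.of_forall fun r hr => ?_)
    have hvr := hpos r (hsub hr)
    have : |w r| * v r ^ (p - 1) ≤ v r ^ p + |w r| ^ p := by
      have e : ∀ x : ℝ, 0 < x → x ^ p = x * x ^ (p - 1) := fun x hx => by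
        rw [mul_comm, ← Real.rpow_add_one hx.ne']; congr 1; ring
      rcases le_total |w r| (v r) with h | h
      · calc |w r| * v r ^ (p - 1) ≤ v r * v r ^ (p - 1) := by gcongr
          _ = v r ^ p := (e _ hvr).symm
          _ ≤ _ := le_add_of_nonneg_right (by positivity)
      · have : v r ^ (p - 1) ≤ |w r| ^ (p - 1) := Real.rpow_le_rpow hvr.le h (by linarith)
        calc |w r| * v r ^ (p - 1) ≤ |w r| * |w r| ^ (p - 1) := by gcongr
          _ = |w r| ^ p := (e _ (hvr.trans_le h)).symm
          _ ≤ _ := le_add_of_nonneg_left (by positivity)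
    simp only [norm_mul, Real.norm_eq_abs, abs_of_pos hp0, Pi.add_apply]
    rw [abs_of_pos (Real.rpow_pos_of_pos hvr _)]
    calc |w r| * p * v r ^ (p - 1) = p * (|w r| * v r ^ (p - 1)) := by ring
      _ ≤ _ := by gcongr

/-- The contribution of `f` becomes negligible with respect to that of the mass term. -/
lemma tendsto_div_zero (hq : p < q) {B t₀ : ℝ} (ht₀ : 0 < t₀)
    (hfB : ∀ t, 0 ≤ t → t ≤ t₀ → |f t| ≤ B * t ^ (q - 1))
    (hpos : ∀ r, 0 < r → 0 < v r) (hlim : Tendsto v atTop (𝓝 0)) :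
    (∀ᶠ r in atTop, |f (v r) / v r ^ (p - 1)| ≤ B * v r ^ (q - p)) ∧
      Tendsto (fun r => f (v r) / v r ^ (p - 1)) atTop (𝓝 0) := by
  have h1 : ∀ᶠ r in atTop, |f (v r) / v r ^ (p - 1)| ≤ B * v r ^ (q - p) := by
    filter_upwards [eventually_gt_atTop 0, hlim.eventually_le_const ht₀] with r hr hvt
    have hvr := hpos r hr
    rw [abs_div, abs_of_pos (Real.rpow_pos_of_pos hvr (p - 1)), div_le_iff₀ (by positivity),
      mul_assoc, ← Real.rpow_add hvr, show q - p + (p - 1) = q - 1 by ring]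
    exact hfB _ hvr.le hvt
  refine ⟨h1, squeeze_zero_norm' h1 ?_⟩
  have := (hlim.rpow_const (p := q - p) (Or.inr (by linarith))).const_mul B
  rwa [Real.zero_rpow (by linarith), mul_zero] at this

lemma eventually_deriv_neg (hv : IsRadialSolution N p μ m f v w) (hp : 1 < p) (hm : 0 < m)
    (hpos : ∀ r, 0 < r → 0 < v r) (hlim : Tendsto v atTop (𝓝 0))
    (hfv : Tendsto (fun r => f (v r) / v r ^ (p - 1)) atTop (𝓝 0)) :
    ∀ᶠ r in atTop, w r < 0 := by
  have hμr : Tendsto (fun r : ℝ => m - μ / r ^ p - f (v r) / v r ^ (p - 1)) atTop (𝓝 m) := by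
    simpa using ((tendsto_const_nhds (x := m)).sub
      ((tendsto_const_nhds (x := μ)).div_atTop (tendsto_rpow_atTop (by linarith : 0 < p)))).sub hfv
  obtain ⟨R, hR⟩ := eventually_atTop.1 ((hμr.eventually_const_lt hm).and (eventually_gt_atTop 0))
  set Φ : ℝ → ℝ := fun r => r ^ (N - 1) * (|w r| ^ (p - 2) * w r) with hΦ
  have hmono : StrictMonoOn Φ (Set.Ici R) := by
    refine strictMonoOn_of_hasDerivWithinAt_pos (convex_Ici R)
      (f' := fun r => r ^ (N - 1) * ((m - μ / r ^ p) * (|v r| ^ (p - 2) * v r) - f (v r)))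
      (fun r hr => (hv.hasDerivAt_flux r (hR r hr).2).continuousAt.continuousWithinAt) ?_ ?_
    · intro r hr
      rw [interior_Ici] at hr
      exact (hv.hasDerivAt_flux r (hR r (le_of_lt hr)).2).hasDerivWithinAt
    · intro r hr
      rw [interior_Ici] at hr
      obtain ⟨h1, h2⟩ := hR r (le_of_lt hr)
      have hvr := hpos r h2
      refine mul_pos (by positivity) ?_
      rw [rpow_mul_self_of_pos hvr]
      have e : (m - μ / r ^ p) * v r ^ (p - 1) - f (v r)
          = (m - μ / r ^ p - f (v r) / v r ^ (p - 1)) * v r ^ (p - 1) := by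
        field_simp
      rw [e]
      positivity
  filter_upwards [eventually_ge_atTop R] with r hr
  by_contra hcon
  push Not at hcon
  have hr0 := (hR r hr).2
  have hΦr : 0 ≤ Φ r := by
    simp only [hΦ]
    positivity
  have hw : ∀ s, r < s → 0 < w s := by
    intro s hs
    have h1 : 0 < Φ s := hΦr.trans_lt (hmono hr (hr.trans hs.le) hs)
    by_contra hc
    push Not at hc
    have : 0 < s := hr0.trans hs
    have : Φ s ≤ 0 := mul_nonpos_of_nonneg_of_nonpos (by positivity)
      (mul_nonpos_of_nonneg_of_nonpos (by positivity) hc)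
    linarith
  have hvm : MonotoneOn v (Set.Ici r) := by
    refine monotoneOn_of_hasDerivWithinAt_nonneg (convex_Ici r) (f' := w)
      (fun s hs => (hv.hasDerivAt s (hr0.trans_le hs)).continuousAt.continuousWithinAt) ?_ ?_
    · intro s hs
      rw [interior_Ici] at hs
      exact (hv.hasDerivAt s (hr0.trans hs)).hasDerivWithinAt
    · intro s hs
      rw [interior_Ici] at hs
      exact (hw s hs).le
  obtain ⟨s, hs1, hs2⟩ := ((hlim.eventually_lt_const (hpos r hr0)).and
    (eventually_ge_atTop r)).exists
  exact absurd (hvm (Set.mem_Ici.2 le_rfl) hs2 hs2) (not_le.2 hs1)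

/-- The function `h = (-v' / v) ^ (p - 1)` satisfies a Riccati equation. -/
lemma hasDerivAt_riccati (hv : IsRadialSolution N p μ m f v w) (hN : 1 ≤ N) (hp : 1 < p)
    (hpos : ∀ r, 0 < r → 0 < v r) {R : ℝ} (hR : 0 < R) (hw : ∀ r, R ≤ r → w r < 0) {r : ℝ}
    (hr : R < r) :
    HasDerivAt (fun r => (-(w r / v r)) ^ (p - 1))
      ((p - 1) * ((-(w r / v r)) ^ (p - 1)) ^ (p / (p - 1))
        - ((N : ℝ) - 1) / r * (-(w r / v r)) ^ (p - 1)
        + (-m + μ / r ^ p + f (v r) / v r ^ (p - 1))) r := by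
  have hp1 : 0 < p - 1 := by linarith
  have hr0 : 0 < r := hR.trans hr
  have hvr := hpos r hr0
  have hwr := hw r hr.le
  have flux_eq : ∀ s, R < s → s ^ (N - 1) * (|w s| ^ (p - 2) * w s)
      = -(s ^ (N - 1) * (-w s) ^ (p - 1)) := by
    intro s hs
    have : 0 < -w s := by linarith [hw s hs.le]
    have h := rpow_mul_self_of_pos (p := p) this
    rw [abs_neg] at h
    rw [← h]
    ring
  have heq : (fun s => (-(w s / v s)) ^ (p - 1)) =ᶠ[𝓝 r] fun s =>
      -(s ^ (N - 1) * (|w s| ^ (p - 2) * w s)) / (s ^ (N - 1) * v s ^ (p - 1)) := by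
    filter_upwards [Ioi_mem_nhds hr] with s hs
    have hs0 : 0 < s := hR.trans hs
    have hvs := hpos s hs0
    have hws : 0 < -w s := by linarith [hw s (le_of_lt hs)]
    rw [flux_eq s hs, ← neg_div, Real.div_rpow hws.le hvs.le]
    field_simp
  have hden := (hasDerivAt_pow (N - 1) r).mul
    ((hv.hasDerivAt r hr0).rpow_const (p := p - 1) (Or.inl hvr.ne'))
  have hd := (hv.hasDerivAt_flux r hr0).neg.div hden (by
    have : 0 < r ^ (N - 1) * v r ^ (p - 1) := by positivity
    exact this.ne')
  refine (HasDerivAt.congr_of_eventuallyEq hd heq).congr_deriv ?_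
  simp only [Pi.neg_apply, Pi.mul_apply]
  rw [flux_eq r hr, rpow_mul_self_of_pos hvr]
  set a := -w r with ha
  have ha0 : 0 < a := by linarith
  have hwa : w r = -a := by simp [ha]
  have hz : -(-a / v r) = a / v r := by ring
  rw [hwa, hz, ← Real.rpow_mul (by positivity),
    show (p - 1) * (p / (p - 1)) = p by field_simp, Real.div_rpow ha0.le hvr.le,
    Real.div_rpow ha0.le hvr.le]
  have e1 : a ^ p = a ^ (p - 1) * a := by
    rw [← Real.rpow_add_one ha0.ne']; congr 1; ring
  have e2 : v r ^ p = v r ^ (p - 1) * v r := by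
    rw [← Real.rpow_add_one hvr.ne']; congr 1; ring
  have e3 : v r ^ (p - 1) = v r ^ (p - 1 - 1) * v r := by
    rw [← Real.rpow_add_one hvr.ne']; congr 1; ring
  have e4 : ((N - 1 : ℕ) : ℝ) * r ^ (N - 1 - 1) * r = ((N : ℝ) - 1) * r ^ (N - 1) := by
    rcases Nat.lt_or_ge 1 N with h | h
    · rw [mul_assoc, ← pow_succ, Nat.sub_add_cancel (by omega), Nat.cast_sub hN]
      simp
    · have : N = 1 := le_antisymm h hN
      subst this
      simp
  have e5 : ((N - 1 : ℕ) : ℝ) * r ^ (N - 1 - 1) = ((N : ℝ) - 1) * r ^ (N - 1) / r := by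
    rw [← e4]; field_simp
  have hA : 0 < a ^ (p - 1) := by positivity
  have hV : 0 < v r ^ (p - 1 - 1) := by positivity
  have hr1 : 0 < r ^ (N - 1) := by positivity
  have hrp : 0 < r ^ p := by positivity
  rw [e5, e1, e2, e3]
  generalize v r ^ (p - 1 - 1) = V at *
  generalize a ^ (p - 1) = A at *
  generalize r ^ (N - 1) = Q at *
  generalize r ^ p = S at *
  field_simp
  ring

/-- The asymptotic expansion of the logarithmic derivative of a positive solution that tends to
zero. -/
lemma riccati_isBigO (hv : IsRadialSolution N p μ m f v w) (hN : 1 ≤ N) (hp : 1 < p)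
    (hm : 0 < m) (hq : p < q) {B t₀ : ℝ} (hB : 0 ≤ B) (ht₀ : 0 < t₀)
    (hfB : ∀ t, 0 ≤ t → t ≤ t₀ → |f t| ≤ B * t ^ (q - 1))
    (hpos : ∀ r, 0 < r → 0 < v r) (hlim : Tendsto v atTop (𝓝 0))
    {k : ℕ} (hk : (k : ℝ) ≤ p) (hk' : p < (k : ℝ) + 1) {c : ℕ → ℝ} (hc : IsCoeffs N p m k c) :
    (∀ᶠ r in atTop, w r < 0) ∧
      (fun r => (-(w r / v r)) ^ (p - 1) - expansion p μ m k c r)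
        =O[atTop] fun r => 1 / r ^ (k + 1) := by
  have hp1 : 0 < p - 1 := by linarith
  obtain ⟨hfle, hf0⟩ := tendsto_div_zero hq ht₀ hfB hpos hlim
  have hneg := hv.eventually_deriv_neg hp hm hpos hlim hf0
  refine ⟨hneg, ?_⟩
  obtain ⟨R, hR⟩ := eventually_atTop.1 (hneg.and (eventually_gt_atTop 0))
  have hR0 : 0 < R := (hR R le_rfl).2
  have hder : ∀ r, R < r → _ := fun r hr =>
    hv.hasDerivAt_riccati hN hp hpos hR0 (fun s hs => (hR s hs).1) hr
  set h : ℝ → ℝ := fun r => (-(w r / v r)) ^ (p - 1) with hh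
  have hz : ∀ r, R ≤ r → 0 < -(w r / v r) := fun r hr => by
    rw [← neg_div]
    exact div_pos (by linarith [(hR r hr).1]) (hpos r (hR r hr).2)
  have hα : 1 < p / (p - 1) := by rw [lt_div_iff₀ hp1]; linarith
  have hc0 := hc.coeff_zero_pos hp hm
  have hμr : Tendsto (fun r : ℝ => μ / r ^ p) atTop (𝓝 0) :=
    tendsto_const_nhds.div_atTop (tendsto_rpow_atTop (by linarith))
  have hνr : Tendsto (fun r : ℝ => -(((N : ℝ) - 1) / r)) atTop (𝓝 0) := by
    simpa using (tendsto_const_nhds (x := (N : ℝ) - 1)).div_atTop tendsto_id |>.neg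
  have hlimh : Tendsto h atTop (𝓝 (c 0)) := by
    refine riccati_tendsto (R := R + 1) hα hp1 hc0 (hc.coeff_zero_rpow hp hm) hνr
      (by simpa using hμr.add hf0) (fun r hr => ?_) (fun r hr => hder r (by linarith))
      (fun r hr => ?_)
    · exact Real.rpow_pos_of_pos (hz r (by linarith)) _
    · ring
  -- exponential decay of `v` makes the contribution of `f` smaller than any power of `r`
  obtain ⟨b, hb, hdecay⟩ : ∃ b > 0, ∀ᶠ r in atTop, w r ≤ -b * v r := by
    refine ⟨(c 0 / 2) ^ (1 / (p - 1)), by positivity, ?_⟩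
    filter_upwards [hlimh.eventually_const_le (half_lt_self hc0), eventually_ge_atTop R] with r h1 hr
    have hvr := hpos r (hR r hr).2
    have h2 := Real.rpow_le_rpow (by positivity) h1 (by positivity : 0 ≤ 1 / (p - 1))
    rw [hh, ← Real.rpow_mul (hz r hr).le, mul_one_div_cancel hp1.ne', Real.rpow_one, ← neg_div,
      le_div_iff₀ hvr] at h2
    linarith
  obtain ⟨R₁, hR₁⟩ := eventually_atTop.1 (hdecay.and (eventually_gt_atTop 0))
  have hexp : ∀ r, R₁ ≤ r → v r ≤ v R₁ * Real.exp (b * R₁) * Real.exp (-b * r) := by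
    have hanti : AntitoneOn (fun r => v r * Real.exp (b * r)) (Set.Ici R₁) := by
      have hd : ∀ r, R₁ ≤ r → HasDerivAt (fun r => v r * Real.exp (b * r))
          ((w r + b * v r) * Real.exp (b * r)) r := fun r hr => by
        have h1 := (((hasDerivAt_id r).const_mul b).exp)
        simp only [id, mul_one] at h1
        exact ((hv.hasDerivAt r (hR₁ r hr).2).mul h1).congr_deriv (by ring)
      refine antitoneOn_of_hasDerivWithinAt_nonpos (convex_Ici R₁)
        (f' := fun r => (w r + b * v r) * Real.exp (b * r))
        (fun r hr => (hd r hr).continuousAt.continuousWithinAt) ?_ ?_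
      · intro r hr
        rw [interior_Ici] at hr
        exact (hd r (le_of_lt hr)).hasDerivWithinAt
      · intro r hr
        rw [interior_Ici] at hr
        exact mul_nonpos_of_nonpos_of_nonneg (by linarith [(hR₁ r (le_of_lt hr)).1])
          (Real.exp_pos _).le
    intro r hr
    have h1 := hanti (Set.mem_Ici.2 le_rfl) (Set.mem_Ici.2 hr) hr
    have e : Real.exp (b * r) * Real.exp (-b * r) = 1 := by
      rw [← Real.exp_add]; simp
    calc v r = v r * Real.exp (b * r) * Real.exp (-b * r) := by rw [mul_assoc, e, mul_one]
      _ ≤ _ := by gcongr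
  have hO : (fun r => f (v r) / v r ^ (p - 1)) =O[atTop] fun r => 1 / r ^ (k + 1) := by
    have h1 : (fun r => f (v r) / v r ^ (p - 1)) =O[atTop]
        fun r => Real.exp (-(b * (q - p)) * r) := by
      refine IsBigO.of_bound (B * (v R₁ * Real.exp (b * R₁)) ^ (q - p)) ?_
      filter_upwards [hfle, eventually_ge_atTop R₁] with r h2 hr
      have hvr := hpos r (hR₁ r hr).2
      have hv1 := hpos R₁ (hR₁ R₁ le_rfl).2
      rw [Real.norm_eq_abs, Real.norm_of_nonneg (Real.exp_pos _).le, mul_assoc]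
      refine h2.trans ?_
      gcongr B * ?_
      rw [show -(b * (q - p)) * r = (-b * r) * (q - p) by ring, Real.exp_mul (-b * r),
        ← Real.mul_rpow (by positivity) (by positivity)]
      exact Real.rpow_le_rpow hvr.le (hexp r hr) (by linarith)
    refine h1.trans ((isLittleO_exp_neg_mul_rpow_atTop (mul_pos hb (by linarith))
      (-((k + 1 : ℕ) : ℝ))).isBigO.congr' EventuallyEq.rfl ?_)
    filter_upwards [eventually_gt_atTop 0] with r hr
    rw [Real.rpow_neg hr.le, Real.rpow_natCast, one_div]
  have hPlim : Tendsto (expansion p μ m k c) atTop (𝓝 (c 0)) := by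
    have h1 : Tendsto (fun r : ℝ => ((p - 1) / m) ^ (1 / p) * μ / (p * r ^ p)) atTop (𝓝 0) :=
      tendsto_const_nhds.div_atTop
        ((tendsto_rpow_atTop (by linarith)).const_mul_atTop (by linarith))
    have h2 : Tendsto (fun r : ℝ => ∑ i ∈ Finset.range (k + 1), c i / r ^ i) atTop
        (𝓝 (∑ i ∈ Finset.range (k + 1), if i = 0 then c 0 else 0)) := by
      refine tendsto_finsetSum _ fun i _ => ?_
      rcases i with _ | i
      · simp
      · simpa using (tendsto_const_nhds (x := c (i + 1))).div_atTop
          (tendsto_pow_atTop (α := ℝ) (Nat.succ_ne_zero i))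
    have h3 := h2.sub h1
    rwa [show (∑ i ∈ Finset.range (k + 1), if i = 0 then c 0 else 0) - 0 = c 0 by simp] at h3
  refine riccati_compare (V := fun r => -m + μ / r ^ p) hα hp1 hc0 hlimh hPlim
    ((eventually_gt_atTop R).mono hder)
    ((eventually_gt_atTop 0).mono fun r hr => hasDerivAt_expansion hp k c hr) (ν := (N : ℝ) - 1)
    ?_ ?_
  · refine hO.congr_left fun r => ?_
    ring
  · refine (expansion_residual_isBigO (μ := μ) hp hm hk hk' hc).congr_left fun r => ?_
    ring

end IsRadialSolution

/-! ### Weak derivatives on the half-line -/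

/-- Smooth functions with compact support in `(0, ∞)`. -/
structure IsRadialTest (η : ℝ → ℝ) : Prop where
  contDiff : ContDiff ℝ ∞ η
  hasCompactSupport : HasCompactSupport η
  tsupport_subset : tsupport η ⊆ Set.Ioi 0

/-- `w` is the weak derivative of `v` on `(0, ∞)`. Since test functions vanish outside `(0, ∞)`,
the integrals may be taken over `ℝ`. -/
structure HasWeakDeriv (v w : ℝ → ℝ) : Prop where
  left : LocallyIntegrableOn v (Set.Ioi 0)
  right : LocallyIntegrableOn w (Set.Ioi 0)
  integral_eq : ∀ η, IsRadialTest η → ∫ r, v r * deriv η r = -∫ r, w r * η r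

lemma exists_Ioo_of_isCompact {K : Set ℝ} (hK : IsCompact K) (h : K ⊆ Set.Ioi 0) :
    ∃ a b : ℝ, 0 < a ∧ a < 1 ∧ 1 < b ∧ K ⊆ Set.Ioo a b := by
  rcases K.eq_empty_or_nonempty with rfl | hne
  · exact ⟨1 / 2, 2, by norm_num, by norm_num, by norm_num, by simp⟩
  obtain ⟨x, hx, hmin⟩ := hK.exists_isMinOn hne continuousOn_id
  obtain ⟨y, hy, hmax⟩ := hK.exists_isMaxOn hne continuousOn_id
  have hx0 : 0 < x := h hx
  refine ⟨min x 1 / 2, max y 1 + 1, by positivity, ?_, ?_, fun z hz => ⟨?_, ?_⟩⟩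
  · linarith [min_le_right x 1]
  · linarith [le_max_right y 1]
  · have : x ≤ z := hmin hz
    have : 0 < min x 1 := by positivity
    linarith [min_le_left x 1]
  · have : z ≤ y := hmax hz
    linarith [le_max_left y 1]

lemma _root_.MeasureTheory.LocallyIntegrableOn.intervalIntegrable_of_pos {w : ℝ → ℝ}
    (hw : LocallyIntegrableOn w (Set.Ioi 0)) {a b : ℝ} (ha : 0 < a) (hb : 0 < b) :
    IntervalIntegrable w volume a b := by
  refine (intervalIntegrable_iff' (by simp)).2 (hw.integrableOn_compact_subset (fun x hx => ?_)
    isCompact_uIcc)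
  exact (lt_min ha hb).trans_le hx.1

namespace IsRadialTest

variable {η : ℝ → ℝ}

lemma exists_Ioo (hη : IsRadialTest η) :
    ∃ a b : ℝ, 0 < a ∧ a < 1 ∧ 1 < b ∧ tsupport η ⊆ Set.Ioo a b :=
  exists_Ioo_of_isCompact hη.hasCompactSupport hη.tsupport_subset

lemma deriv (hη : IsRadialTest η) : IsRadialTest (deriv η) where
  contDiff := (contDiff_infty_iff_deriv.1 hη.contDiff).2
  hasCompactSupport := hη.hasCompactSupport.deriv
  tsupport_subset := (closure_minimal support_deriv_subset isClosed_closure).trans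
    hη.tsupport_subset

lemma differentiable (hη : IsRadialTest η) : Differentiable ℝ η :=
  hη.contDiff.differentiable (by simp)

lemma continuous (hη : IsRadialTest η) : Continuous η := hη.contDiff.continuous

lemma eq_zero_of_nonpos (hη : IsRadialTest η) {r : ℝ} (hr : r ≤ 0) : η r = 0 :=
  image_eq_zero_of_notMem_tsupport fun h => not_lt.2 hr (hη.tsupport_subset h)

lemma add {θ : ℝ → ℝ} (hη : IsRadialTest η) (hθ : IsRadialTest θ) :
    IsRadialTest (fun r => η r + θ r) where
  contDiff := hη.contDiff.add hθ.contDiff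
  hasCompactSupport := hη.hasCompactSupport.add hθ.hasCompactSupport
  tsupport_subset := (tsupport_add η θ).trans (Set.union_subset hη.tsupport_subset
    hθ.tsupport_subset)

/-- The product of a test function with a function that is smooth on `(0, ∞)`. -/
lemma mul_of_contDiffAt (hη : IsRadialTest η) {g : ℝ → ℝ} (hg : ∀ r, 0 < r → ContDiffAt ℝ ∞ g r) :
    IsRadialTest (fun r => g r * η r) where
  contDiff := contDiff_iff_contDiffAt.2 fun r => by
    by_cases hr : r ∈ tsupport η
    · exact (hg r (hη.tsupport_subset hr)).mul hη.contDiff.contDiffAt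
    · refine (contDiffAt_const (c := (0 : ℝ))).congr_of_eventuallyEq ?_
      filter_upwards [(isClosed_tsupport η).isOpen_compl.mem_nhds hr] with s hs
      rw [image_eq_zero_of_notMem_tsupport hs, mul_zero]
  hasCompactSupport := hη.hasCompactSupport.mul_left
  tsupport_subset := (tsupport_mul_subset_right).trans hη.tsupport_subset

lemma const_mul (hη : IsRadialTest η) (c : ℝ) : IsRadialTest (fun r => c * η r) :=
  hη.mul_of_contDiffAt fun _ _ => contDiffAt_const

lemma integrable_mul (hη : IsRadialTest η) {v : ℝ → ℝ} (hv : LocallyIntegrableOn v (Set.Ioi 0)) :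
    Integrable (fun r => v r * η r) := by
  obtain ⟨a, b, ha, -, -, hab⟩ := hη.exists_Ioo
  have h1 : IntegrableOn v (Set.Icc a b) := hv.integrableOn_compact_subset
    (fun x hx => ha.trans_le hx.1) isCompact_Icc
  have h2 := h1.mul_continuousOn hη.continuous.continuousOn isCompact_Icc
  refine (integrableOn_iff_integrable_of_support_subset ?_).1 h2
  intro r hr
  refine Set.Ioo_subset_Icc_self (hab (subset_tsupport _ ?_))
  exact fun h => hr (by simp [h])

/-- A test function with vanishing integral has a primitive that is a test function. -/
lemma exists_primitive (hη : IsRadialTest η) (h0 : ∫ r, η r = 0) :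
    ∃ θ, IsRadialTest θ ∧ _root_.deriv θ = η := by
  obtain ⟨a, b, ha, ha1, hb1, hab⟩ := hη.exists_Ioo
  have hd : ∀ r, HasDerivAt (fun r => ∫ s in a..r, η s) (η r) r := fun r =>
    intervalIntegral.integral_hasDerivAt_right (hη.continuous.intervalIntegrable _ _)
      (hη.continuous.stronglyMeasurableAtFilter _ _) hη.continuous.continuousAt
  have hderiv : _root_.deriv (fun r => ∫ s in a..r, η s) = η := funext fun r => (hd r).deriv
  have hsupp : Function.support (fun r => ∫ s in a..r, η s) ⊆ Set.Icc a b := by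
    intro r hr
    by_contra hcon
    refine hr ?_
    rw [Set.mem_Icc, not_and_or, not_le, not_le] at hcon
    rcases hcon with h | h
    · refine intervalIntegral.integral_zero_ae (Eventually.of_forall fun s hs => ?_)
      rw [Set.uIoc_of_ge h.le] at hs
      exact image_eq_zero_of_notMem_tsupport fun hs' => not_lt.2 hs.2 (hab hs').1
    · change ∫ s in a..r, η s = 0
      rw [← h0, intervalIntegral.integral_of_le (by linarith)]
      refine setIntegral_eq_integral_of_forall_compl_eq_zero fun s hs => ?_
      refine image_eq_zero_of_notMem_tsupport fun hs' => hs ⟨(hab hs').1, ?_⟩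
      exact (hab hs').2.le.trans h.le
  refine ⟨_, ⟨contDiff_infty_iff_deriv.2 ⟨fun r => (hd r).differentiableAt, ?_⟩,
    HasCompactSupport.of_support_subset_isCompact isCompact_Icc hsupp,
    (closure_minimal hsupp isClosed_Icc).trans fun r hr => ha.trans_le hr.1⟩, hderiv⟩
  rw [hderiv]
  exact hη.contDiff

end IsRadialTest

/-- A test function that is nonnegative and equal to `1` on `[a, b]`. -/
lemma exists_radialTest_eq_one {a b : ℝ} (ha : 0 < a) (hab : a < b) :
    ∃ χ, IsRadialTest χ ∧ (∀ r, 0 ≤ χ r) ∧ ∀ r ∈ Set.Icc a b, χ r = 1 := by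
  let χ : ContDiffBump ((a + b) / 2) :=
    ⟨(b - a) / 2, (b - a) / 2 + a / 2, by linarith, by linarith⟩
  refine ⟨χ, ⟨χ.contDiff, χ.hasCompactSupport, ?_⟩, fun _ => χ.nonneg, fun r hr => ?_⟩
  · rw [χ.tsupport_eq, Real.closedBall_eq_Icc]
    intro r hr
    have h1 : (a + b) / 2 - ((b - a) / 2 + a / 2) ≤ r := hr.1
    exact Set.mem_Ioi.2 (by linarith)
  · refine χ.one_of_mem_closedBall ?_
    rw [Real.closedBall_eq_Icc]
    exact ⟨by change (a + b) / 2 - (b - a) / 2 ≤ r; linarith [hr.1],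
      by change r ≤ (a + b) / 2 + (b - a) / 2; linarith [hr.2]⟩

/-- It is enough to test with nonnegative functions. -/
lemma HasWeakDeriv.of_nonneg {v w : ℝ → ℝ} (hv : LocallyIntegrableOn v (Set.Ioi 0))
    (hw : LocallyIntegrableOn w (Set.Ioi 0))
    (h : ∀ η, IsRadialTest η → (∀ r, 0 ≤ η r) → ∫ r, v r * deriv η r = -∫ r, w r * η r) :
    HasWeakDeriv v w := by
  refine ⟨hv, hw, fun η hη => ?_⟩
  obtain ⟨a, b, ha, ha1, hb1, hab⟩ := hη.exists_Ioo
  obtain ⟨χ, hχ, hχ0, hχ1⟩ := exists_radialTest_eq_one ha (ha1.trans hb1)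
  obtain ⟨C, hC⟩ := hη.hasCompactSupport.exists_bound_of_continuous hη.continuous
  have hχC := hχ.const_mul |C|
  have hsum := hη.add hχC
  have h1 := h _ hχC fun r => mul_nonneg (abs_nonneg _) (hχ0 r)
  have h2 := h _ hsum fun r => by
    by_cases hr : r ∈ tsupport η
    · rw [hχ1 r (Set.Ioo_subset_Icc_self (hab hr)), mul_one]
      have := (abs_le.1 (hC r)).1
      linarith [le_abs_self C]
    · rw [image_eq_zero_of_notMem_tsupport hr, zero_add]
      exact mul_nonneg (abs_nonneg _) (hχ0 r)
  have hd : deriv (fun r => η r + |C| * χ r) = fun r => deriv η r + deriv (fun r => |C| * χ r) r :=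
    funext fun r => deriv_fun_add (hη.differentiable r) (hχC.differentiable r)
  rw [hd] at h2
  simp only [mul_add] at h2
  rw [integral_add (hη.deriv.integrable_mul hv) (hχC.deriv.integrable_mul hv),
    integral_add (hη.integrable_mul hw) (hχC.integrable_mul hw), h1] at h2
  linarith

/-- The primitive of a locally integrable function is weakly differentiable. -/
lemma integral_primitive_mul_deriv {w η : ℝ → ℝ} (hw : LocallyIntegrableOn w (Set.Ioi 0))
    (hη : IsRadialTest η) :
    ∫ r, (∫ s in (1 : ℝ)..r, w s) * deriv η r = -∫ r, w r * η r := by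
  obtain ⟨a, b, ha, ha1, hb1, hab⟩ := hη.exists_Ioo
  have hle : a ≤ b := by linarith
  have hz : ∀ {θ : ℝ → ℝ}, tsupport θ ⊆ Set.Ioo a b → ∀ g : ℝ → ℝ,
      ∫ r in a..b, g r * θ r = ∫ r, g r * θ r := by
    intro θ hθ g
    rw [intervalIntegral.integral_of_le hle]
    refine setIntegral_eq_integral_of_forall_compl_eq_zero fun s hs => ?_
    rw [image_eq_zero_of_notMem_tsupport fun hs' => hs (Set.Ioo_subset_Ioc_self (hθ hs')), mul_zero]
  have hwi := hw.intervalIntegrable_of_pos ha (by linarith : 0 < b)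
  have h1mem : (1 : ℝ) ∈ Set.uIcc a b := by
    rw [Set.uIcc_of_le hle]
    exact ⟨ha1.le, hb1.le⟩
  have hac := hwi.absolutelyContinuousOnInterval_intervalIntegral h1mem
  have hηac : AbsolutelyContinuousOnInterval η a b :=
    (hη.contDiff.of_le (by simp)).contDiffOn.absolutelyContinuousOnInterval
  have key := hac.integral_mul_deriv_eq_deriv_mul hηac
  have ha0 : η a = 0 := image_eq_zero_of_notMem_tsupport fun h => lt_irrefl _ (hab h).1
  have hb0 : η b = 0 := image_eq_zero_of_notMem_tsupport fun h => lt_irrefl _ (hab h).2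
  have hsupp' : tsupport (deriv η) ⊆ Set.Ioo a b :=
    (closure_minimal support_deriv_subset isClosed_closure).trans hab
  rw [ha0, hb0, hz hsupp' (fun x => ∫ v in (1 : ℝ)..x, w v)] at key
  rw [key, ← hz hab w]
  simp only [mul_zero, sub_zero, zero_sub, neg_inj]
  refine intervalIntegral.integral_congr_ae ?_
  filter_upwards [hwi.ae_hasDerivAt_integral] with r hr hr'
  rw [(hr (Set.uIoc_subset_uIcc hr') 1 h1mem).deriv]

lemma continuousOn_primitive_Ioi {w : ℝ → ℝ} (hw : LocallyIntegrableOn w (Set.Ioi 0)) :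
    ContinuousOn (fun r => ∫ s in (1 : ℝ)..r, w s) (Set.Ioi 0) := by
  intro r hr
  have hr0 : 0 < r := hr
  set a := min r 1 / 2
  set b := max r 1 + 1
  have ha : 0 < a := by positivity
  have har : a < min r 1 := half_lt_self (by positivity)
  have hb : max r 1 < b := lt_add_one _
  have hb0 : 0 < b := lt_of_lt_of_le (by positivity) hb.le
  have hle : a ≤ b := (har.le.trans (min_le_left _ _)).trans ((le_max_left _ _).trans hb.le)
  have h1 := (hw.intervalIntegrable_of_pos ha hb0).absolutelyContinuousOnInterval_intervalIntegral
    (c := 1) (by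
      rw [Set.uIcc_of_le hle]
      exact ⟨har.le.trans (min_le_right _ _), (le_max_right _ _).trans hb.le⟩)
  have h2 := h1.continuousOn
  rw [Set.uIcc_of_le hle] at h2
  refine (h2.continuousAt (Icc_mem_nhds ?_ ?_)).continuousWithinAt
  · exact har.trans_le (min_le_left _ _)
  · exact lt_of_le_of_lt (le_max_left _ _) hb

/-- The lemma of du Bois-Reymond: a weakly differentiable function is the primitive of its weak
derivative. -/
lemma HasWeakDeriv.ae_eq_primitive {v w : ℝ → ℝ} (h : HasWeakDeriv v w) :
    ∃ C : ℝ, ∀ᵐ r ∂volume.restrict (Set.Ioi (0 : ℝ)), v r = C + ∫ s in (1 : ℝ)..r, w s := by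
  set V : ℝ → ℝ := fun r => ∫ s in (1 : ℝ)..r, w s with hV
  have hVi : LocallyIntegrableOn V (Set.Ioi 0) :=
    (continuousOn_primitive_Ioi h.right).locallyIntegrableOn measurableSet_Ioi
  have hzi : LocallyIntegrableOn (fun r => v r - V r) (Set.Ioi 0) := h.left.sub hVi
  have hz : ∀ η, IsRadialTest η → ∫ r, (v r - V r) * deriv η r = 0 := by
    intro η hη
    simp only [sub_mul]
    rw [integral_sub (hη.deriv.integrable_mul h.left) (hη.deriv.integrable_mul hVi),
      h.integral_eq η hη, integral_primitive_mul_deriv h.right hη, sub_self]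
  let χ : ContDiffBump (1 : ℝ) := ⟨1 / 4, 1 / 2, by norm_num, by norm_num⟩
  have hχ : IsRadialTest (χ.normed volume) := by
    refine ⟨χ.contDiff_normed, χ.hasCompactSupport_normed, ?_⟩
    rw [χ.tsupport_normed_eq, Real.closedBall_eq_Icc]
    intro r hr
    have h1 : (1 : ℝ) - 1 / 2 ≤ r := hr.1
    exact Set.mem_Ioi.2 (by linarith)
  have hχ1 : ∫ r, χ.normed volume r = 1 := χ.integral_normed
  have hint : ∀ {η : ℝ → ℝ}, IsRadialTest η → Integrable η := fun hη =>
    hη.continuous.integrable_of_hasCompactSupport hη.hasCompactSupport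
  set C := ∫ r, (v r - V r) * χ.normed volume r with hC
  refine ⟨C, (ae_restrict_iff' measurableSet_Ioi).2 ?_⟩
  have key := isOpen_Ioi.ae_eq_zero_of_integral_contDiff_smul_eq_zero (μ := volume)
    (f := fun r => v r - V r - C) (U := Set.Ioi (0 : ℝ))
    (hzi.sub ((continuousOn_const (c := C)).locallyIntegrableOn measurableSet_Ioi)) ?_
  · filter_upwards [key] with r hr hr0
    linarith [hr hr0]
  · intro ψ h1 h2 h3
    have hψ : IsRadialTest ψ := ⟨h1, h2, h3⟩
    have hcχ := hχ.const_mul (-∫ r, ψ r)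
    obtain ⟨θ, hθ, hθ'⟩ := (hψ.add hcχ).exists_primitive (by
      rw [integral_add (hint hψ) (hint hcχ), integral_const_mul, hχ1]
      ring)
    have h4 := hz θ hθ
    rw [hθ'] at h4
    simp only [mul_add] at h4
    rw [integral_add (hψ.integrable_mul hzi) (hcχ.integrable_mul hzi)] at h4
    have h5 : ∫ r, (v r - V r) * ((-∫ r, ψ r) * χ.normed volume r) = (-∫ r, ψ r) * C := by
      rw [hC, ← integral_const_mul]
      congr 1
      ext r
      ring
    rw [h5] at h4
    have h6 : ∫ r, ψ r • (v r - V r - C) = ∫ r, ((v r - V r) * ψ r - C * ψ r) := by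
      congr 1
      ext r
      simp only [smul_eq_mul]
      ring
    rw [h6, integral_sub (hψ.integrable_mul hzi) ((hint hψ).const_mul C), integral_const_mul]
    linarith

/-! ### Polar coordinates -/

lemma nontrivial_E {N : ℕ} (hN : 1 ≤ N) : Nontrivial (E N) :=
  Module.nontrivial_of_finrank_pos (R := ℝ) (by simpa [Nat.pos_iff_ne_zero] using Nat.one_le_iff_ne_zero.1 hN)

/-- The surface measure of the unit sphere of `ℝ^N`. -/
def sphereArea (N : ℕ) : ℝ := N * (volume : Measure (E N)).real (Metric.ball 0 1)

lemma sphereArea_pos {N : ℕ} (hN : 1 ≤ N) : 0 < sphereArea N := by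
  have h : 0 < (volume : Measure (E N)).real (Metric.ball 0 1) :=
    ENNReal.toReal_pos (Metric.measure_ball_pos _ _ one_pos).ne' measure_ball_lt_top.ne
  have : (0 : ℝ) < N := by exact_mod_cast hN
  exact mul_pos this h

lemma integral_radial {N : ℕ} (hN : 1 ≤ N) (g : ℝ → ℝ) :
    ∫ x : E N, g ‖x‖ = sphereArea N * ∫ r in Set.Ioi (0 : ℝ), r ^ (N - 1) * g r := by
  have := nontrivial_E hN
  rw [integral_fun_norm_addHaar volume g]
  simp [sphereArea, mul_assoc]

lemma integrable_radial_iff {N : ℕ} (hN : 1 ≤ N) {g : ℝ → ℝ} :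
    Integrable (fun x : E N => g ‖x‖) ↔
      IntegrableOn (fun r => r ^ (N - 1) * g r) (Set.Ioi 0) := by
  have := nontrivial_E hN
  rw [integrable_fun_norm_addHaar volume]
  simp

lemma measurePreserving_polar (N : ℕ) : MeasurePreserving (homeomorphUnitSphereProd (E N))
    ((volume : Measure (E N)).comap (↑))
      ((volume : Measure (E N)).toSphere.prod (Measure.volumeIoiPow (N - 1))) := by
  simpa using (volume : Measure (E N)).measurePreserving_homeomorphUnitSphereProd

lemma ae_volumeIoiPow_iff {n : ℕ} {P : ℝ → Prop} :
    (∀ᵐ r : Set.Ioi (0 : ℝ) ∂Measure.volumeIoiPow n, P r) ↔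
      ∀ᵐ r ∂volume.restrict (Set.Ioi (0 : ℝ)), P r := by
  rw [Measure.volumeIoiPow, ae_withDensity_iff (by fun_prop),
    ae_restrict_iff_subtype measurableSet_Ioi]
  refine eventually_congr (Eventually.of_forall fun r => ?_)
  have hr : (0 : ℝ) < r := r.2
  have : ENNReal.ofReal ((r : ℝ) ^ n) ≠ 0 := (ENNReal.ofReal_pos.2 (by positivity)).ne'
  exact ⟨fun h => h this, fun h _ => h⟩

lemma ae_radial_iff {N : ℕ} (hN : 1 ≤ N) {P : ℝ → Prop} :
    (∀ᵐ x : E N, P ‖x‖) ↔ ∀ᵐ r ∂volume.restrict (Set.Ioi (0 : ℝ)), P r := by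
  have := nontrivial_E hN
  have hemb : MeasurableEmbedding (homeomorphUnitSphereProd (E N)) :=
    Homeomorph.measurableEmbedding _
  have : NeZero (volume : Measure (E N)).toSphere := ⟨Measure.toSphere_ne_zero _⟩
  have h1 : (∀ᵐ x : E N, P ‖x‖) ↔ ∀ᵐ x ∂(volume : Measure (E N)).restrict {0}ᶜ, P ‖x‖ := by
    rw [restrict_compl_singleton]
  have h2 : (∀ᵐ y ∂(volume : Measure (E N)).toSphere.prod (Measure.volumeIoiPow (N - 1)),
      P y.2) ↔ ∀ᵐ r : Set.Ioi (0 : ℝ) ∂Measure.volumeIoiPow (N - 1), P r := by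
    constructor
    · intro h
      obtain ⟨x, hx⟩ := (Measure.ae_ae_of_ae_prod h).exists
      exact hx
    · intro h
      exact Measure.quasiMeasurePreserving_snd.ae h
  rw [h1, ae_restrict_iff_subtype (measurableSet_singleton _).compl, ← ae_volumeIoiPow_iff
    (n := N - 1), ← h2, ← (measurePreserving_polar N).map_eq, hemb.ae_map_iff]
  simp only [homeomorphUnitSphereProd_apply_snd_coe]

/-- Integration in polar coordinates. -/
lemma integral_polar {N : ℕ} (hN : 1 ≤ N) {F : E N → ℝ} (hF : Integrable F) :
    IntegrableOn (fun r : ℝ => r ^ (N - 1) *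
        ∫ θ, F (r • (θ : E N)) ∂(volume : Measure (E N)).toSphere) (Set.Ioi 0) ∧
      ∫ x, F x = ∫ r in Set.Ioi (0 : ℝ), r ^ (N - 1) *
        ∫ θ, F (r • (θ : E N)) ∂(volume : Measure (E N)).toSphere := by
  have := nontrivial_E hN
  have hemb : MeasurableEmbedding (homeomorphUnitSphereProd (E N)) :=
    Homeomorph.measurableEmbedding _
  set Fp : Metric.sphere (0 : E N) 1 × Set.Ioi (0 : ℝ) → ℝ := fun y => F ((y.2 : ℝ) • (y.1 : E N))
    with hFp
  have hcomp : ∀ x : ({(0 : E N)}ᶜ : Set (E N)), Fp (homeomorphUnitSphereProd (E N) x) = F x := by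
    intro x
    have hx : ‖(x : E N)‖ ≠ 0 := norm_ne_zero_iff.2 x.2
    simp only [hFp, homeomorphUnitSphereProd_apply_fst_coe, homeomorphUnitSphereProd_apply_snd_coe,
      smul_smul, mul_inv_cancel₀ hx, one_smul]
  have hFpi : Integrable Fp
      ((volume : Measure (E N)).toSphere.prod (Measure.volumeIoiPow (N - 1))) := by
    rw [← (measurePreserving_polar N).integrable_comp_emb hemb]
    refine Integrable.congr (f := fun x : ({(0 : E N)}ᶜ : Set (E N)) => F x) ?_
      (Eventually.of_forall fun x => (hcomp x).symm)
    exact (integrableOn_iff_comap_subtypeVal (measurableSet_singleton _).compl).1 hF.integrableOn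
  have hg := hFpi.integral_prod_right
  have hval : ∀ g : ℝ → ℝ, ∫ r, g r ∂Measure.volumeIoiPow (N - 1)
      = ∫ r in Set.Ioi (0 : ℝ), r ^ (N - 1) * g r := by
    intro g
    simp only [Measure.volumeIoiPow, ENNReal.ofReal]
    rw [integral_withDensity_eq_integral_smul
      (measurable_subtype_coe.pow_const _).real_toNNReal,
      integral_subtype_comap measurableSet_Ioi fun a : ℝ => Real.toNNReal (a ^ (N - 1)) • g a]
    refine setIntegral_congr_fun measurableSet_Ioi fun x hx => ?_
    simp only [NNReal.smul_def, Real.coe_toNNReal _ (pow_nonneg (le_of_lt hx) _), smul_eq_mul]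
  constructor
  · rw [integrableOn_iff_comap_subtypeVal measurableSet_Ioi]
    rw [Measure.volumeIoiPow, integrable_withDensity_iff_integrable_smul' (by fun_prop)
      (by simp)] at hg
    refine hg.congr (Eventually.of_forall fun r => ?_)
    have hr : (0 : ℝ) < r := r.2
    simp only [Function.comp, hFp, smul_eq_mul]
    rw [ENNReal.toReal_ofReal (by positivity)]
  · calc ∫ x, F x = ∫ x : ({(0 : E N)}ᶜ : Set (E N)), F x ∂((volume : Measure (E N)).comap (↑)) := by
          rw [integral_subtype_comap (measurableSet_singleton _).compl, restrict_compl_singleton]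
      _ = ∫ y, Fp y ∂((volume : Measure (E N)).toSphere.prod (Measure.volumeIoiPow (N - 1))) := by
          rw [← (measurePreserving_polar N).integral_comp hemb]
          exact integral_congr_ae (Eventually.of_forall fun x => (hcomp x).symm)
      _ = ∫ r, ∫ θ, Fp (θ, r) ∂(volume : Measure (E N)).toSphere
            ∂Measure.volumeIoiPow (N - 1) := integral_prod_symm _ hFpi
      _ = _ := hval fun r => ∫ θ, F (r • (θ : E N)) ∂(volume : Measure (E N)).toSphere

/-! ### Radial functions and their derivatives -/

lemma hasFDerivAt_radial {N : ℕ} {V : ℝ → ℝ} {V' : ℝ} {x : E N} (hx : x ≠ 0)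
    (h : HasDerivAt V V' ‖x‖) :
    HasFDerivAt (fun y : E N => V ‖y‖) ((V' / ‖x‖) • innerSL ℝ x) x := by
  have hn : HasFDerivAt (fun y : E N => ‖y‖) (‖x‖⁻¹ • innerSL ℝ x) x := by
    have h1 := (hasStrictFDerivAt_norm_sq x).hasFDerivAt.sqrt (by simpa using hx)
    simp only [Real.sqrt_sq (norm_nonneg _)] at h1
    refine h1.congr_fderiv ?_
    ext y
    simp
    ring
  refine (h.comp_hasFDerivAt x hn).congr_fderiv ?_
  rw [smul_smul, div_eq_mul_inv]

namespace IsRadialTest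

variable {N : ℕ} {η : ℝ → ℝ}

lemma eventually_radial_eq_zero (hη : IsRadialTest η) :
    (fun y : E N => η ‖y‖) =ᶠ[𝓝 0] fun _ => 0 := by
  obtain ⟨a, b, ha, -, -, hab⟩ := hη.exists_Ioo
  filter_upwards [Metric.ball_mem_nhds (0 : E N) ha] with y hy
  refine image_eq_zero_of_notMem_tsupport fun h => ?_
  rw [mem_ball_zero_iff] at hy
  exact lt_asymm hy (hab h).1

lemma isTestFunction_radial (hη : IsRadialTest η) :
    IsTestFunction (fun x : E N => η ‖x‖) := by
  constructor
  · refine contDiff_iff_contDiffAt.2 fun x => ?_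
    rcases eq_or_ne x 0 with rfl | hx
    · exact contDiffAt_const.congr_of_eventuallyEq hη.eventually_radial_eq_zero
    · exact hη.contDiff.contDiffAt.comp x (contDiffAt_norm ℝ hx)
  · obtain ⟨a, b, ha, -, -, hab⟩ := hη.exists_Ioo
    refine HasCompactSupport.of_support_subset_isCompact (isCompact_closedBall (0 : E N) b) ?_
    intro x hx
    rw [mem_closedBall_zero_iff]
    exact (hab (subset_tsupport _ hx)).2.le

lemma hasFDerivAt_radial (hη : IsRadialTest η) (x : E N) :
    HasFDerivAt (fun y : E N => η ‖y‖) ((_root_.deriv η ‖x‖ / ‖x‖) • innerSL ℝ x) x := by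
  rcases eq_or_ne x 0 with rfl | hx
  · simpa using (hasFDerivAt_const (0 : ℝ) (0 : E N)).congr_of_eventuallyEq
      hη.eventually_radial_eq_zero
  · exact HardyPLaplace.hasFDerivAt_radial hx (hη.differentiable _).hasDerivAt

lemma gradient_radial (hη : IsRadialTest η) (x : E N) :
    gradient (fun y : E N => η ‖y‖) x = (_root_.deriv η ‖x‖ / ‖x‖) • x := by
  refine HasGradientAt.gradient ?_
  rw [hasGradientAt_iff_hasFDerivAt]
  refine (hη.hasFDerivAt_radial x).congr_fderiv ?_
  ext y
  simp

end IsRadialTest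

lemma integrable_mul_of_tsupport_subset {N : ℕ} {U : Set (E N)} {F ψ : E N → ℝ}
    (hF : LocallyIntegrableOn F U) (hψ : Continuous ψ) (hc : HasCompactSupport ψ)
    (hU : tsupport ψ ⊆ U) : Integrable (fun x => F x * ψ x) := by
  have h1 : IntegrableOn F (tsupport ψ) := hF.integrableOn_compact_subset hU hc
  refine (integrableOn_iff_integrable_of_support_subset ?_).1
    (h1.mul_continuousOn hψ.continuousOn hc)
  intro x hx
  exact subset_tsupport _ fun h => hx (by simp [h])

lemma _root_.MeasureTheory.LocallyIntegrable.integrable_mul {N : ℕ} {F ψ : E N → ℝ}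
    (hF : LocallyIntegrable F) (hψ : Continuous ψ) (hc : HasCompactSupport ψ) :
    Integrable (fun x => F x * ψ x) :=
  hF.integrable_smul_right_of_hasCompactSupport hψ hc

/-- Local integrability on `(0, ∞)` is not affected by the weight `r ^ n`. -/
lemma locallyIntegrableOn_of_pow_mul {n : ℕ} {v : ℝ → ℝ}
    (h : LocallyIntegrableOn (fun r => r ^ n * v r) (Set.Ioi 0)) :
    LocallyIntegrableOn v (Set.Ioi 0) := by
  rw [locallyIntegrableOn_iff isOpen_Ioi.isLocallyClosed] at h ⊢
  intro K hK hKc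
  have h1 := (h K hK hKc).continuousOn_mul (g := fun r => (r ^ n)⁻¹)
    ((continuousOn_pow n).inv₀ fun r hr => (pow_pos (hK hr) n).ne') hKc
  refine h1.congr_fun (fun r hr => ?_) hKc.measurableSet
  have : 0 < r ^ n := pow_pos (hK hr) n
  field_simp

lemma locallyIntegrableOn_of_radial {N : ℕ} (hN : 1 ≤ N) {v : ℝ → ℝ}
    (h : LocallyIntegrable (fun x : E N => v ‖x‖)) : LocallyIntegrableOn v (Set.Ioi 0) := by
  refine locallyIntegrableOn_of_pow_mul (n := N - 1) ?_
  rw [locallyIntegrableOn_iff isOpen_Ioi.isLocallyClosed]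
  intro K hK hKc
  obtain ⟨a, b, ha, -, -, hab⟩ := exists_Ioo_of_isCompact hKc hK
  have h1 : Integrable (fun x : E N => (Set.Iic b).indicator v ‖x‖) := by
    refine (((h.integrableOn_isCompact (isCompact_closedBall (0 : E N) b)).integrable_indicator
      measurableSet_closedBall)).congr (Eventually.of_forall fun x => ?_)
    simp [Set.indicator]
  have h2 := (integrable_radial_iff hN).1 h1
  refine (h2.mono_set hK).congr_fun (fun r hr => ?_) hKc.measurableSet
  have : r ∈ Set.Iic b := (hab hr).2.le
  simp [this]

lemma locallyIntegrableOn_radial {N : ℕ} (hN : 1 ≤ N) {w : ℝ → ℝ}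
    (hw : LocallyIntegrableOn w (Set.Ioi 0)) :
    LocallyIntegrableOn (fun x : E N => w ‖x‖) {0}ᶜ := by
  rw [locallyIntegrableOn_iff isOpen_compl_singleton.isLocallyClosed]
  intro K hK hKc
  obtain ⟨a, b, ha, -, -, hab⟩ := exists_Ioo_of_isCompact (hKc.image continuous_norm) (by
    rintro _ ⟨x, hx, rfl⟩
    exact norm_pos_iff.2 (hK hx))
  have h1 : IntegrableOn (fun r => r ^ (N - 1) * w r) (Set.Icc a b) :=
    (hw.integrableOn_compact_subset (fun x hx => ha.trans_le hx.1) isCompact_Icc).continuousOn_mul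
      (continuousOn_pow _) isCompact_Icc
  have h2 : Integrable (fun x : E N => (Set.Icc a b).indicator w ‖x‖) := by
    rw [integrable_radial_iff hN]
    refine ((h1.integrable_indicator measurableSet_Icc).congr
      (Eventually.of_forall fun r => ?_)).integrableOn
    by_cases hr : r ∈ Set.Icc a b <;> simp [hr]
  refine h2.integrableOn.congr_fun (fun x hx => ?_) hKc.measurableSet
  have : ‖x‖ ∈ Set.Icc a b := Set.Ioo_subset_Icc_self (hab ⟨x, hx, rfl⟩)
  simp [this]

lemma integral_Ioi_eq_of_radialTest {η : ℝ → ℝ} (hη : IsRadialTest η) (g : ℝ → ℝ) :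
    ∫ r in Set.Ioi (0 : ℝ), g r * η r = ∫ r, g r * η r :=
  setIntegral_eq_integral_of_forall_compl_eq_zero fun r hr => by
    rw [hη.eq_zero_of_nonpos (not_lt.1 hr), mul_zero]

/-- The weighted average over spheres of a locally integrable function. -/
lemma exists_radial_average {N : ℕ} (hN : 1 ≤ N) {H : E N → ℝ} (hH : LocallyIntegrable H) :
    ∃ g : ℝ → ℝ, LocallyIntegrableOn g (Set.Ioi 0) ∧
      ∀ η, IsRadialTest η → ∫ x, H x * η ‖x‖ = ∫ r, g r * η r := by
  have hnorm : ∀ (r : ℝ), 0 < r → ∀ θ : Metric.sphere (0 : E N) 1, ‖r • (θ : E N)‖ = r := by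
    intro r hr θ
    rw [norm_smul, norm_eq_of_mem_sphere, mul_one, Real.norm_of_nonneg hr.le]
  refine ⟨fun r => r ^ (N - 1) * ∫ θ, H (r • (θ : E N)) ∂(volume : Measure (E N)).toSphere,
    ?_, fun η hη => ?_⟩
  · rw [locallyIntegrableOn_iff isOpen_Ioi.isLocallyClosed]
    intro K hK hKc
    obtain ⟨a, b, ha, -, -, hab⟩ := exists_Ioo_of_isCompact hKc hK
    have h1 := (integral_polar hN ((hH.integrableOn_isCompact (isCompact_closedBall (0 : E N)
      b)).integrable_indicator measurableSet_closedBall)).1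
    refine (h1.mono_set hK).congr_fun (fun r hr => ?_) hKc.measurableSet
    simp only
    congr 2
    ext θ
    refine Set.indicator_of_mem ?_ _
    rw [mem_closedBall_zero_iff, hnorm r (hK hr)]
    exact (hab hr).2.le
  · obtain ⟨h1, h2⟩ := hη.isTestFunction_radial (N := N)
    rw [(integral_polar hN (hH.integrable_mul h1.continuous h2)).2,
      ← integral_Ioi_eq_of_radialTest hη]
    refine setIntegral_congr_fun measurableSet_Ioi fun r hr => ?_
    simp only [hnorm r hr]
    rw [integral_mul_const]
    ring

lemma _root_.MeasureTheory.LocallyIntegrable.coord {N : ℕ} {G : E N → E N}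
    (hG : LocallyIntegrable G) (i : Fin N) : LocallyIntegrable (fun x => G x i) := by
  intro x
  obtain ⟨s, hs, h⟩ := hG x
  exact ⟨s, hs, (EuclideanSpace.proj (𝕜 := ℝ) i).integrable_comp h⟩

/-- The profile of a radial weakly differentiable function is weakly differentiable on `(0, ∞)`.
Its derivative is found by testing with the vector fields `η(|x|) |x| ^ (-N) x`, whose divergence
is `η'(|x|) |x| ^ (1 - N)`. -/
lemma IsWeakGradient.hasWeakDeriv_profile {N : ℕ} (hN : 1 ≤ N) {u : E N → ℝ} {G : E N → E N}
    {v : ℝ → ℝ} (hG : IsWeakGradient u G) (hv : IsProfile u v) : ∃ w, HasWeakDeriv v w := by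
  obtain ⟨hu, hGi, hweak⟩ := hG
  have hvi : LocallyIntegrableOn v (Set.Ioi 0) :=
    locallyIntegrableOn_of_radial hN (hu.congr hv)
  set H : E N → ℝ := fun x => ∑ i, G x i * x i with hH
  have hcoord : ∀ i : Fin N, Continuous fun x : E N => x i := fun i =>
    (EuclideanSpace.proj (𝕜 := ℝ) i).continuous
  have hHi : LocallyIntegrable H := by
    rw [locallyIntegrable_iff]
    intro K hK
    exact integrable_finsetSum _ fun i _ =>
      ((hGi.coord i).integrableOn_isCompact hK).mul_continuousOn (hcoord i).continuousOn hK
  obtain ⟨g, hg, hgη⟩ := exists_radial_average hN hHi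
  have hσ := sphereArea_pos hN
  have hinv : ∀ r : ℝ, 0 < r → ContDiffAt ℝ ∞ (fun r : ℝ => (r ^ N)⁻¹) r := fun r hr =>
    (contDiff_id.pow N).contDiffAt.inv (by simpa using (pow_pos hr N).ne')
  refine ⟨fun r => (sphereArea N)⁻¹ * (r ^ N)⁻¹ * g r, hvi, ?_, fun η hη => ?_⟩
  · rw [locallyIntegrableOn_iff isOpen_Ioi.isLocallyClosed] at hg ⊢
    intro K hK hKc
    refine (hg K hK hKc).continuousOn_mul (g := fun r => (sphereArea N)⁻¹ * (r ^ N)⁻¹)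
      (continuousOn_const.mul ?_) hKc
    exact (continuousOn_pow N).inv₀ fun r hr => (pow_pos (hK hr) N).ne'
  set ζ : ℝ → ℝ := fun r => (r ^ N)⁻¹ * η r with hζdef
  have hζ : IsRadialTest ζ := hη.mul_of_contDiffAt hinv
  have htest : ∀ i : Fin N, IsTestFunction (fun x : E N => ζ ‖x‖ * x i) := fun i =>
    ⟨hζ.isTestFunction_radial.1.mul (EuclideanSpace.proj (𝕜 := ℝ) i).contDiff,
      hζ.isTestFunction_radial.2.mul_right⟩
  have hfd : ∀ (i : Fin N) (x : E N),
      fderiv ℝ (fun x : E N => ζ ‖x‖ * x i) x (EuclideanSpace.single i 1)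
        = deriv ζ ‖x‖ / ‖x‖ * (x i * x i) + ζ ‖x‖ := by
    intro i x
    have h1 := (hζ.hasFDerivAt_radial x).mul (EuclideanSpace.proj (𝕜 := ℝ) i).hasFDerivAt
    have h2 : HasFDerivAt (fun x : E N => ζ ‖x‖ * x i) _ x := h1
    rw [h2.fderiv]
    simp [EuclideanSpace.inner_single_right]
    ring
  have hsum : ∫ x, u x * (deriv ζ ‖x‖ * ‖x‖ + N * ζ ‖x‖) = -∫ x, H x * ζ ‖x‖ := by
    have hL : ∀ x : E N, u x * (deriv ζ ‖x‖ * ‖x‖ + N * ζ ‖x‖) = ∑ i : Fin N,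
        u x * fderiv ℝ (fun x : E N => ζ ‖x‖ * x i) x (EuclideanSpace.single i 1) := by
      intro x
      simp only [hfd]
      rw [← Finset.mul_sum, Finset.sum_add_distrib, ← Finset.mul_sum]
      have : ∑ i, x i * x i = ‖x‖ ^ 2 := by
        rw [EuclideanSpace.real_norm_sq_eq]
        exact Finset.sum_congr rfl fun i _ => by ring
      rw [this]
      simp only [Finset.sum_const, Finset.card_univ, Fintype.card_fin, nsmul_eq_mul]
      rcases eq_or_ne ‖x‖ 0 with h | h
      · simp [h]
      · field_simp
    have hR : ∀ x : E N, H x * ζ ‖x‖ = ∑ i, G x i * (ζ ‖x‖ * x i) := by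
      intro x
      simp only [hH, Finset.sum_mul]
      exact Finset.sum_congr rfl fun i _ => by ring
    simp only [hL, hR]
    rw [integral_finsetSum, integral_finsetSum, ← Finset.sum_neg_distrib]
    · exact Finset.sum_congr rfl fun i _ => hweak _ (htest i) i
    · exact fun i _ => (hGi.coord i).integrable_mul (htest i).1.continuous (htest i).2
    · intro i _
      refine hu.integrable_mul ?_ ?_
      · exact ((htest i).1.continuous_fderiv (by simp)).clm_apply continuous_const
      · exact (htest i).2.fderiv_apply ℝ _
  rw [hgη ζ hζ] at hsum
  have hcongr : ∫ x, u x * (deriv ζ ‖x‖ * ‖x‖ + N * ζ ‖x‖)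
      = ∫ x : E N, v ‖x‖ * (deriv ζ ‖x‖ * ‖x‖ + N * ζ ‖x‖) :=
    integral_congr_ae (hv.mono fun x hx => by simp only [hx])
  rw [hcongr, integral_radial hN fun r => v r * (deriv ζ r * r + N * ζ r)] at hsum
  have hdiv : ∫ r in Set.Ioi (0 : ℝ), r ^ (N - 1) * (v r * (deriv ζ r * r + N * ζ r))
      = ∫ r in Set.Ioi (0 : ℝ), v r * deriv η r := by
    refine setIntegral_congr_fun measurableSet_Ioi fun r hr => ?_
    have hr0 : 0 < r := hr
    have hd : HasDerivAt ζ _ r := ((hasDerivAt_pow N r).inv (pow_pos hr0 N).ne').mul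
      (hη.differentiable r).hasDerivAt
    obtain ⟨n, rfl⟩ : ∃ n, N = n + 1 := ⟨N - 1, by omega⟩
    rw [hd.deriv]
    simp only [hζdef, Nat.add_sub_cancel, Pi.inv_apply]
    field_simp
    ring
  rw [hdiv, integral_Ioi_eq_of_radialTest hη.deriv] at hsum
  have h3 : ∫ r, (sphereArea N)⁻¹ * (r ^ N)⁻¹ * g r * η r
      = (sphereArea N)⁻¹ * ∫ r, g r * ζ r := by
    rw [← integral_const_mul]
    congr 1
    ext r
    simp only [hζdef]
    ring
  rw [h3, ← mul_neg, ← hsum]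
  field_simp

/-! ### The weak gradient of a radial function -/

lemma IsWeakGradient.ae_unique {N : ℕ} {u : E N → ℝ} {G G' : E N → E N}
    (h : IsWeakGradient u G) (h' : IsWeakGradient u G') : G =ᵐ[volume] G' := by
  have key : ∀ i : Fin N, ∀ᵐ x, G x i - G' x i = 0 := by
    intro i
    refine ae_eq_zero_of_integral_contDiff_smul_eq_zero ((h.2.1.coord i).sub (h'.2.1.coord i)) ?_
    intro φ h1 h2
    have e1 := h.2.2 φ ⟨h1, h2⟩ i
    have e2 := h'.2.2 φ ⟨h1, h2⟩ i
    simp only [smul_eq_mul, mul_sub]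
    simp only [mul_comm (φ _)]
    rw [integral_sub ((h.2.1.coord i).integrable_mul h1.continuous h2)
      ((h'.2.1.coord i).integrable_mul h1.continuous h2)]
    linarith
  filter_upwards [ae_all_iff.2 key] with x hx
  ext i
  linarith [hx i]

lemma continuous_radial_component_mul {N : ℕ} {φ : E N → ℝ} (hφ : Continuous φ)
    (h0 : tsupport φ ⊆ {0}ᶜ) (e : E N) :
    Continuous (fun x => inner ℝ x e / ‖x‖ * φ x) := by
  refine continuous_iff_continuousAt.2 fun x => ?_
  rcases eq_or_ne x 0 with rfl | hx
  · refine (continuousAt_const (y := (0 : ℝ))).congr ?_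
    have : (tsupport φ)ᶜ ∈ 𝓝 (0 : E N) :=
      (isClosed_tsupport φ).isOpen_compl.mem_nhds fun h => h0 h rfl
    filter_upwards [this] with y hy
    rw [image_eq_zero_of_notMem_tsupport hy, mul_zero]
  · have : ‖x‖ ≠ 0 := norm_ne_zero_iff.2 hx
    have h1 : Continuous fun x : E N => inner ℝ x e := by fun_prop
    exact (h1.continuousAt.div continuous_norm.continuousAt this).mul hφ.continuousAt

/-- Integration by parts for a radial function with continuous radial derivative. -/
lemma integral_primitive_radial_mul_fderiv_of_continuous {N : ℕ} {w : ℝ → ℝ}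
    (hw : Continuous w) {φ : E N → ℝ} (hφ : IsTestFunction φ) (h0 : tsupport φ ⊆ {0}ᶜ) (e : E N)
    (C : ℝ) :
    ∫ x : E N, (C + ∫ s in (1 : ℝ)..‖x‖, w s) * fderiv ℝ φ x e
      = -∫ x : E N, w ‖x‖ * (inner ℝ x e / ‖x‖ * φ x) := by
  set V : ℝ → ℝ := fun r => C + ∫ s in (1 : ℝ)..r, w s with hV
  have hd : ∀ r, HasDerivAt V (w r) r := fun r =>
    (intervalIntegral.integral_hasDerivAt_right (hw.intervalIntegrable _ _)
      (hw.stronglyMeasurableAtFilter _ _) hw.continuousAt).const_add C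
  have hVc : Continuous fun x : E N => V ‖x‖ :=
    (continuous_iff_continuousAt.2 fun r => (hd r).continuousAt).comp continuous_norm
  have hfd : ∀ x, fderiv ℝ (fun x : E N => V ‖x‖) x e * φ x
      = w ‖x‖ * (inner ℝ x e / ‖x‖ * φ x) := by
    intro x
    by_cases hx : x ∈ tsupport φ
    · rw [(hasFDerivAt_radial (h0 hx) (hd ‖x‖)).fderiv]
      simp only [smul_apply, innerSL_apply_apply, smul_eq_mul]
      ring
    · rw [image_eq_zero_of_notMem_tsupport hx]
      simp
  have hψ := continuous_radial_component_mul hφ.1.continuous h0 e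
  have key := integral_mul_fderiv_eq_neg_fderiv_mul_of_integrable (μ := (volume : Measure (E N)))
    (f := fun x : E N => V ‖x‖) (g := φ) (v := e) ?_ ?_ ?_
    (fun x hx => (hasFDerivAt_radial (h0 hx) (hd ‖x‖)).differentiableAt)
    (fun x _ => hφ.1.differentiable (by simp) x)
  · rw [key]
    simp only [hfd]
  · simp only [hfd]
    exact Continuous.integrable_of_hasCompactSupport ((hw.comp continuous_norm).mul hψ)
      (hφ.2.mul_left.mul_left)
  · exact Continuous.integrable_of_hasCompactSupport
      (hVc.mul ((hφ.1.continuous_fderiv (by simp)).clm_apply continuous_const))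
      (hφ.2.fderiv_apply ℝ e).mul_left
  · exact Continuous.integrable_of_hasCompactSupport (hVc.mul hφ.1.continuous) hφ.2.mul_left

/-- Integration by parts for a radial function whose radial derivative is merely locally
integrable, by approximation in `L¹`. -/
lemma integral_primitive_radial_mul_fderiv {N : ℕ} (hN : 1 ≤ N) {w : ℝ → ℝ}
    (hw : LocallyIntegrableOn w (Set.Ioi 0)) {φ : E N → ℝ} (hφ : IsTestFunction φ)
    (h0 : tsupport φ ⊆ {0}ᶜ) (e : E N) (C : ℝ) :
    ∫ x : E N, (C + ∫ s in (1 : ℝ)..‖x‖, w s) * fderiv ℝ φ x e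
      = -∫ x : E N, w ‖x‖ * (inner ℝ x e / ‖x‖ * φ x) := by
  obtain ⟨a, b, ha, ha1, hb1, hab⟩ := exists_Ioo_of_isCompact (hφ.2.isCompact.image continuous_norm)
    (by
      rintro _ ⟨x, hx, rfl⟩
      exact norm_pos_iff.2 (h0 hx))
  have hsupp : ∀ x ∈ tsupport φ, ‖x‖ ∈ Set.Icc a b := fun x hx =>
    Set.Ioo_subset_Icc_self (hab ⟨x, hx, rfl⟩)
  set ψ : E N → ℝ := fun x => inner ℝ x e / ‖x‖ * φ x with hψdef
  have hψ : Continuous ψ := continuous_radial_component_mul hφ.1.continuous h0 e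
  have hψc : HasCompactSupport ψ := hφ.2.mul_left
  have hψ0 : ∀ x, x ∉ tsupport φ → ψ x = 0 := fun x hx => by
    simp [hψdef, image_eq_zero_of_notMem_tsupport hx]
  have hψs : tsupport ψ ⊆ {0}ᶜ := tsupport_mul_subset_right.trans h0
  obtain ⟨M, hM⟩ := hψc.exists_bound_of_continuous hψ
  have hM0 : 0 ≤ M := (norm_nonneg _).trans (hM 0)
  have hdφ : Continuous fun x => fderiv ℝ φ x e :=
    (hφ.1.continuous_fderiv (by simp)).clm_apply continuous_const
  have hdφc : HasCompactSupport fun x => fderiv ℝ φ x e := hφ.2.fderiv_apply ℝ e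
  have hdφ0 : ∀ x, x ∉ tsupport φ → fderiv ℝ φ x e = 0 := fun x hx => by
    have : fderiv ℝ φ x = 0 := by
      by_contra h
      exact hx (support_fderiv_subset ℝ h)
    simp [this]
  have hdφs : tsupport (fun x => fderiv ℝ φ x e) ⊆ {0}ᶜ :=
    (closure_minimal (fun x hx => by
      by_contra h
      exact hx (hdφ0 x h)) (isClosed_tsupport φ)).trans h0
  set D := ∫ x, ‖fderiv ℝ φ x e‖ with hD
  set K := D + M * (sphereArea N * b ^ (N - 1)) with hK
  have hb0 : 0 < b := by linarith
  have hσ := sphereArea_pos hN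
  have hK0 : 0 ≤ K := by
    have : 0 ≤ D := integral_nonneg fun _ => norm_nonneg _
    positivity
  have hw1 : Integrable ((Set.Icc a b).indicator w) :=
    (hw.integrableOn_compact_subset (fun x hx => ha.trans_le hx.1)
      isCompact_Icc).integrable_indicator measurableSet_Icc
  set L := ∫ x : E N, (C + ∫ s in (1 : ℝ)..‖x‖, w s) * fderiv ℝ φ x e with hL
  set R := ∫ x : E N, w ‖x‖ * ψ x with hR
  -- The identity holds for continuous `w`; approximate `w` in `L¹` on `[a, b]`.
  have main : ∀ ε > 0, |L + R| ≤ K * ε := by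
    intro ε hε
    obtain ⟨w', -, hww', hw'c, hw'i⟩ := hw1.exists_hasCompactSupport_integral_sub_le hε
    have hdi : Integrable fun s => ‖(Set.Icc a b).indicator w s - w' s‖ := (hw1.sub hw'i).norm
    have hkey := integral_primitive_radial_mul_fderiv_of_continuous hw'c hφ h0 e C
    have hw'l : LocallyIntegrableOn w' (Set.Ioi 0) :=
      hw'c.locallyIntegrable.locallyIntegrableOn _
    have hprim : ∀ {z : ℝ → ℝ}, LocallyIntegrableOn z (Set.Ioi 0) →
        Integrable fun x : E N => (C + ∫ s in (1 : ℝ)..‖x‖, z s) * fderiv ℝ φ x e := fun hz =>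
      integrable_mul_of_tsupport_subset (locallyIntegrableOn_radial hN
        ((continuousOn_const.add (continuousOn_primitive_Ioi hz)).locallyIntegrableOn
          measurableSet_Ioi)) hdφ hdφc hdφs
    have hrad : ∀ {z : ℝ → ℝ}, LocallyIntegrableOn z (Set.Ioi 0) →
        Integrable fun x : E N => z ‖x‖ * ψ x := fun hz =>
      integrable_mul_of_tsupport_subset (locallyIntegrableOn_radial hN hz) hψ hψc hψs
    -- The primitives differ by at most `ε` uniformly on the support of `φ`.
    have e1 : |L - ∫ x : E N, (C + ∫ s in (1 : ℝ)..‖x‖, w' s) * fderiv ℝ φ x e| ≤ ε * D := by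
      rw [hL, ← integral_sub (hprim hw) (hprim hw'l), ← Real.norm_eq_abs, hD,
        ← integral_const_mul]
      refine norm_integral_le_of_norm_le ((hdφ.norm.integrable_of_hasCompactSupport
        hdφc.norm).const_mul ε) (Eventually.of_forall fun x => ?_)
      by_cases hx : x ∈ tsupport φ
      · have hxab := hsupp x hx
        have hx0 : 0 < ‖x‖ := ha.trans_le hxab.1
        rw [← sub_mul, norm_mul]
        gcongr
        rw [add_sub_add_left_eq_sub, ← intervalIntegral.integral_sub
          (hw.intervalIntegrable_of_pos one_pos hx0) (hw'c.intervalIntegrable _ _)]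
        refine (intervalIntegral.norm_integral_le_integral_norm_uIoc).trans ?_
        refine le_trans ?_ hww'
        have hsub : Set.uIoc 1 ‖x‖ ⊆ Set.Icc a b := by
          intro s hs
          rcases Set.mem_uIoc.1 hs with h | h
          · exact ⟨by linarith [h.1], h.2.trans hxab.2⟩
          · exact ⟨hxab.1.trans h.1.le, by linarith [h.2]⟩
        calc ∫ s in Set.uIoc 1 ‖x‖, ‖w s - w' s‖
            = ∫ s in Set.uIoc 1 ‖x‖, ‖(Set.Icc a b).indicator w s - w' s‖ := by
              refine setIntegral_congr_fun measurableSet_uIoc fun s hs => ?_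
              simp only [Set.indicator_of_mem (hsub hs)]
          _ ≤ _ := setIntegral_le_integral hdi (Eventually.of_forall fun _ => norm_nonneg _)
      · simp [hdφ0 x hx]
    -- `w ‖x‖` itself is only `L¹`-close, which polar coordinates carry over to `E N`.
    have e2 : |R - ∫ x : E N, w' ‖x‖ * ψ x| ≤ M * (sphereArea N * b ^ (N - 1)) * ε := by
      rw [hR, ← integral_sub (hrad hw) (hrad hw'l), ← Real.norm_eq_abs]
      set g : ℝ → ℝ := (Set.Icc a b).indicator
        fun s => M * ‖(Set.Icc a b).indicator w s - w' s‖ with hg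
      have hgi : Integrable fun r => r ^ (N - 1) * g r := by
        have h1 := (((hdi.const_mul M).integrableOn (s := Set.Icc a b)).continuousOn_mul
          (continuousOn_pow (N - 1)) isCompact_Icc).integrable_indicator measurableSet_Icc
        refine h1.congr (Eventually.of_forall fun r => ?_)
        by_cases hr : r ∈ Set.Icc a b <;> simp [hg, hr]
      have hgi' : Integrable fun x : E N => g ‖x‖ := (integrable_radial_iff hN).2 hgi.integrableOn
      refine (norm_integral_le_of_norm_le hgi' (Eventually.of_forall fun x => ?_)).trans ?_
      · by_cases hx : x ∈ tsupport φ
        · simp only [hg, Set.indicator_of_mem (hsupp x hx)]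
          rw [← sub_mul, norm_mul, mul_comm]
          gcongr
          exact hM x
        · rw [hψ0 x hx]
          simp only [mul_zero, sub_zero, norm_zero]
          exact Set.indicator_nonneg (fun _ _ => mul_nonneg hM0 (norm_nonneg _)) _
      · rw [integral_radial hN g]
        have h2 : ∫ r in Set.Ioi (0 : ℝ), r ^ (N - 1) * g r
            ≤ ∫ r in Set.Ioi (0 : ℝ),
              b ^ (N - 1) * M * ‖(Set.Icc a b).indicator w r - w' r‖ := by
          refine setIntegral_mono_on hgi.integrableOn (hdi.const_mul _).integrableOn
            measurableSet_Ioi fun r hr => ?_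
          have hr0 : 0 < r := hr
          by_cases hrab : r ∈ Set.Icc a b
          · simp only [hg, Set.indicator_of_mem hrab, ← mul_assoc]
            gcongr
            exact hrab.2
          · simp only [hg, Set.indicator_of_notMem hrab, mul_zero]
            positivity
        have h3 : ∫ r in Set.Ioi (0 : ℝ), b ^ (N - 1) * M * ‖(Set.Icc a b).indicator w r - w' r‖
            ≤ b ^ (N - 1) * M * ε := by
          refine (setIntegral_le_integral (hdi.const_mul _)
            (Eventually.of_forall fun _ => by positivity)).trans ?_
          rw [integral_const_mul]
          gcongr
        calc _ ≤ sphereArea N * (b ^ (N - 1) * M * ε) := by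
              gcongr
              exact h2.trans h3
          _ = _ := by ring
    rw [hkey] at e1
    have e3 : L + R = (L - -∫ x : E N, w' ‖x‖ * ψ x) + (R - ∫ x : E N, w' ‖x‖ * ψ x) := by ring
    rw [e3]
    refine (abs_add_le _ _).trans ?_
    rw [hK, add_mul]
    linarith
  have : |L + R| = 0 := by
    refine le_antisymm (le_of_forall_pos_le_add fun ε hε => ?_) (abs_nonneg _)
    rw [zero_add]
    refine (main (ε / (K + 1)) (by positivity)).trans ?_
    rw [mul_div_assoc', div_le_iff₀ (by positivity)]
    nlinarith
  linarith [abs_eq_zero.1 this]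

/-- The weak gradient of a radial function is the radial derivative times the radial unit vector. -/
lemma IsWeakGradient.ae_eq_radial {N : ℕ} (hN : 1 ≤ N) {u : E N → ℝ} {G : E N → E N}
    {w : ℝ → ℝ} {C : ℝ} (hG : IsWeakGradient u G) (hw : LocallyIntegrableOn w (Set.Ioi 0))
    (hu : IsProfile u fun r => C + ∫ s in (1 : ℝ)..r, w s) :
    ∀ᵐ x : E N, x ≠ 0 ∧ G x = (w ‖x‖ / ‖x‖) • x := by
  have := nontrivial_E hN
  have key : ∀ i : Fin N, ∀ᵐ x : E N, x ∈ ({0}ᶜ : Set (E N)) →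
      G x i - w ‖x‖ * (inner ℝ x (EuclideanSpace.single i 1) / ‖x‖) = 0 := by
    intro i
    have hlw : LocallyIntegrableOn
        (fun x : E N => w ‖x‖ * (inner ℝ x (EuclideanSpace.single i (1 : ℝ)) / ‖x‖)) {0}ᶜ := by
      have h := locallyIntegrableOn_radial hN hw
      rw [locallyIntegrableOn_iff isOpen_compl_singleton.isLocallyClosed] at h ⊢
      intro K hK hKc
      refine (h K hK hKc).mul_continuousOn (ContinuousOn.div ?_ continuous_norm.continuousOn
        fun x hx => norm_ne_zero_iff.2 (hK hx)) hKc
      exact Continuous.continuousOn (by fun_prop)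
    refine isOpen_compl_singleton.ae_eq_zero_of_integral_contDiff_smul_eq_zero
      (((hG.2.1.coord i).locallyIntegrableOn _).sub hlw) ?_
    intro φ h1 h2 h3
    have e1 := hG.2.2 φ ⟨h1, h2⟩ i
    have e2 := integral_primitive_radial_mul_fderiv hN hw ⟨h1, h2⟩ h3
      (EuclideanSpace.single i 1) C
    have e3 : ∫ x, u x * fderiv ℝ φ x (EuclideanSpace.single i 1)
        = ∫ x : E N, (C + ∫ s in (1 : ℝ)..‖x‖, w s) * fderiv ℝ φ x (EuclideanSpace.single i 1) :=
      integral_congr_ae (hu.mono fun x hx => by simp only [hx])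
    simp only [smul_eq_mul, mul_sub]
    simp only [mul_comm (φ _), mul_assoc]
    rw [integral_sub ((hG.2.1.coord i).integrable_mul h1.continuous h2)
      (integrable_mul_of_tsupport_subset (locallyIntegrableOn_radial hN hw)
        (continuous_radial_component_mul h1.continuous h3 _) h2.mul_left
        (tsupport_mul_subset_right.trans h3))]
    linarith
  have hne : ∀ᵐ x : E N, x ≠ 0 := by
    simp [ae_iff]
  filter_upwards [ae_all_iff.2 key, hne] with x hx hx0
  refine ⟨hx0, ?_⟩
  ext i
  have := hx i hx0
  simp only [EuclideanSpace.inner_single_right, conj_trivial, one_mul] at this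
  rw [PiLp.smul_apply, smul_eq_mul]
  linear_combination this

/-! ### From the weak formulation to the radial equation -/

lemma continuous_abs_rpow_mul_self {p : ℝ} (hp : 1 < p) :
    Continuous fun x : ℝ => |x| ^ (p - 2) * x := by
  have hp1 : 0 < p - 1 := by linarith
  have h : (fun x : ℝ => |x| ^ (p - 2) * x) = fun x => max x 0 ^ (p - 1) - max (-x) 0 ^ (p - 1) := by
    ext x
    rcases lt_trichotomy x 0 with hx | rfl | hx
    · have hx' : 0 < -x := by linarith
      have := rpow_mul_self_of_pos (p := p) hx'
      rw [abs_neg] at this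
      rw [max_eq_right hx.le, max_eq_left hx'.le, Real.zero_rpow hp1.ne', ← this]
      ring
    · simp
    · rw [rpow_mul_self_of_pos hx, max_eq_left hx.le, max_eq_right (by linarith),
        Real.zero_rpow hp1.ne', sub_zero]
  rw [h]
  exact ((continuous_id.max continuous_const).rpow_const fun _ => Or.inr hp1.le).sub
    ((continuous_neg.max continuous_const).rpow_const fun _ => Or.inr hp1.le)

/-- The maps `x ↦ |x| ^ (p - 2) x` for conjugate exponents are inverse to each other. -/
lemma abs_rpow_mul_self_inverse {p q : ℝ} (hpq : (p - 1) * (q - 1) = 1) (x : ℝ) :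
    |(|x| ^ (p - 2) * x)| ^ (q - 2) * (|x| ^ (p - 2) * x) = x := by
  rcases eq_or_ne x 0 with rfl | hx
  · simp
  have h0 : 0 < |x| := abs_pos.2 hx
  have e : |(|x| ^ (p - 2) * x)| = |x| ^ (p - 1) := by
    rw [abs_mul, abs_of_pos (Real.rpow_pos_of_pos h0 _), ← Real.rpow_add_one h0.ne']
    congr 1
    ring
  rw [e, ← Real.rpow_mul h0.le, ← mul_assoc, ← Real.rpow_add h0,
    show (p - 1) * (q - 2) + (p - 2) = 0 by linear_combination hpq, Real.rpow_zero, one_mul]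

/-- The flux `r ^ (N - 1) |w| ^ (p - 2) w` is locally integrable. -/
lemma locallyIntegrableOn_flux {n : ℕ} {p : ℝ} (hp : 1 < p) {w : ℝ → ℝ}
    (hw : LocallyIntegrableOn w (Set.Ioi 0))
    (hwp : IntegrableOn (fun r => r ^ n * |w r| ^ p) (Set.Ioi 0)) :
    LocallyIntegrableOn (fun r => r ^ n * (|w r| ^ (p - 2) * w r)) (Set.Ioi 0) := by
  rw [locallyIntegrableOn_iff isOpen_Ioi.isLocallyClosed]
  intro K hK hKc
  have h1 : IntegrableOn (fun r : ℝ => r ^ n) K :=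
    (continuousOn_pow n).integrableOn_compact hKc
  refine Integrable.mono' (h1.add (hwp.mono_set hK)) ?_ ?_
  · have h2 := (hw.integrableOn_compact_subset hK hKc).aestronglyMeasurable
    exact ((continuous_pow n).aestronglyMeasurable).mul
      ((continuous_abs_rpow_mul_self hp).comp_aestronglyMeasurable h2)
  · refine (ae_restrict_iff' hKc.measurableSet).2 (Eventually.of_forall fun r hr => ?_)
    have hr0 : 0 < r := hK hr
    rw [Real.norm_eq_abs, abs_mul, abs_rpow_mul_self hp, abs_of_pos (pow_pos hr0 n), Pi.add_apply]
    have h3 : |w r| ^ (p - 1) ≤ 1 + |w r| ^ p := by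
      rcases le_total |w r| 1 with h | h
      · have := Real.rpow_le_one (abs_nonneg (w r)) h (by linarith : 0 ≤ p - 1)
        have : 0 ≤ |w r| ^ p := by positivity
        linarith
      · have := Real.rpow_le_rpow_of_exponent_le h (by linarith : p - 1 ≤ p)
        linarith
    calc r ^ n * |w r| ^ (p - 1) ≤ r ^ n * (1 + |w r| ^ p) := by gcongr
      _ = _ := by ring

/-- For radial functions the weak formulation with radial test functions is the weak form of the
radial equation. -/
lemma hasWeakDeriv_flux {N : ℕ} (hN : 1 ≤ N) {p μ m : ℝ} (hp : 1 < p) {f : ℝ → ℝ}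
    (hf : Continuous f) {u : E N → ℝ} {G : E N → E N} {V w : ℝ → ℝ}
    (hsol : ∀ φ : E N → ℝ, IsTestFunction φ → (∀ x, 0 ≤ φ x) →
      weakForm p μ m u G φ = ∫ x, f (u x) * φ x)
    (hu : IsProfile u V) (hV : ContinuousOn V (Set.Ioi 0))
    (hG : ∀ᵐ x : E N, x ≠ 0 ∧ G x = (w ‖x‖ / ‖x‖) • x)
    (hflux : LocallyIntegrableOn (fun r => r ^ (N - 1) * (|w r| ^ (p - 2) * w r)) (Set.Ioi 0)) :
    ContinuousOn (fun r => r ^ (N - 1) *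
        ((m - μ / r ^ p) * (|V r| ^ (p - 2) * V r) - f (V r))) (Set.Ioi 0) ∧
      HasWeakDeriv (fun r => r ^ (N - 1) * (|w r| ^ (p - 2) * w r))
      (fun r => r ^ (N - 1) * ((m - μ / r ^ p) * (|V r| ^ (p - 2) * V r) - f (V r))) := by
  have hσ := sphereArea_pos hN
  have hA : ContinuousOn (fun r => r ^ (N - 1) * ((m - μ / r ^ p) * (|V r| ^ (p - 2) * V r)))
      (Set.Ioi 0) := by
    refine (continuousOn_pow _).mul (ContinuousOn.mul ?_ ?_)
    · refine continuousOn_const.sub (continuousOn_const.div ?_ ?_)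
      · exact continuousOn_id.rpow_const fun r _ => Or.inr (by linarith)
      · exact fun r hr => (Real.rpow_pos_of_pos hr p).ne'
    · exact (continuous_abs_rpow_mul_self hp).comp_continuousOn hV
  have hB : ContinuousOn (fun r => r ^ (N - 1) * f (V r)) (Set.Ioi 0) :=
    (continuousOn_pow _).mul (hf.comp_continuousOn hV)
  have hAB : ContinuousOn (fun r => r ^ (N - 1) *
      ((m - μ / r ^ p) * (|V r| ^ (p - 2) * V r) - f (V r))) (Set.Ioi 0) :=
    (hA.sub hB).congr fun r _ => mul_sub _ _ _
  refine ⟨hAB, HasWeakDeriv.of_nonneg hflux (hAB.locallyIntegrableOn measurableSet_Ioi) ?_⟩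
  intro η hη hη0
  have h1 := hsol _ hη.isTestFunction_radial fun x => hη0 ‖x‖
  set K₁ : ℝ → ℝ := fun r => |w r| ^ (p - 2) * w r * deriv η r
    + (m - μ / r ^ p) * (|V r| ^ (p - 2) * V r) * η r with hK₁
  set K₂ : ℝ → ℝ := fun r => f (V r) * η r with hK₂
  have hL : weakForm p μ m u G (fun x => η ‖x‖) = ∫ x : E N, K₁ ‖x‖ := by
    refine integral_congr_ae ?_
    filter_upwards [hG, hu] with x hx hux
    have hx0 : ‖x‖ ≠ 0 := norm_ne_zero_iff.2 hx.1
    have hn : ‖(w ‖x‖ / ‖x‖) • x‖ = |w ‖x‖| := by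
      rw [norm_smul, norm_div, norm_norm, Real.norm_eq_abs]
      field_simp
    have hi : inner ℝ ((w ‖x‖ / ‖x‖) • x) ((deriv η ‖x‖ / ‖x‖) • x) = w ‖x‖ * deriv η ‖x‖ := by
      rw [real_inner_smul_left, real_inner_smul_right, real_inner_self_eq_norm_sq]
      field_simp
    rw [hK₁, hη.gradient_radial, hx.2, hn, hi, hux]
    ring
  have hR : ∫ x, f (u x) * η ‖x‖ = ∫ x : E N, K₂ ‖x‖ :=
    integral_congr_ae (hu.mono fun x hx => by simp only [hx, hK₂])
  rw [hL, hR, integral_radial hN K₁, integral_radial hN K₂] at h1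
  have h2 := mul_left_cancel₀ hσ.ne' h1
  have iF := hη.deriv.integrable_mul hflux
  have iA := hη.integrable_mul (hA.locallyIntegrableOn measurableSet_Ioi (μ := volume))
  have iB := hη.integrable_mul (hB.locallyIntegrableOn measurableSet_Ioi (μ := volume))
  have e1 : ∫ r in Set.Ioi (0 : ℝ), r ^ (N - 1) * K₁ r
      = (∫ r, r ^ (N - 1) * (|w r| ^ (p - 2) * w r) * deriv η r)
        + ∫ r, r ^ (N - 1) * ((m - μ / r ^ p) * (|V r| ^ (p - 2) * V r)) * η r := by
    rw [← integral_Ioi_eq_of_radialTest hη.deriv, ← integral_Ioi_eq_of_radialTest hη,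
      ← integral_add iF.integrableOn iA.integrableOn]
    congr 1
    ext r
    ring
  have e2 : ∫ r in Set.Ioi (0 : ℝ), r ^ (N - 1) * K₂ r
      = ∫ r, r ^ (N - 1) * f (V r) * η r := by
    rw [← integral_Ioi_eq_of_radialTest hη]
    congr 1
    ext r
    ring
  have e3 : ∫ r, r ^ (N - 1) * ((m - μ / r ^ p) * (|V r| ^ (p - 2) * V r) - f (V r)) * η r
      = (∫ r, r ^ (N - 1) * ((m - μ / r ^ p) * (|V r| ^ (p - 2) * V r)) * η r)
        - ∫ r, r ^ (N - 1) * f (V r) * η r := by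
    rw [← integral_sub iA iB]
    congr 1
    ext r
    ring
  rw [e1, e2] at h2
  rw [e3]
  linarith

/-- A radial function in `W^{1,p}` that solves the equation weakly has a `C¹` profile that solves
the radial equation. -/
lemma IsWeakSolution.exists_isRadialSolution {N : ℕ} (hN : 1 ≤ N) {p μ m : ℝ} (hp : 1 < p)
    {f : ℝ → ℝ} (hf : Continuous f) {u : E N → ℝ} (hu : IsWeakSolution p μ m f u)
    (hrad : IsRadial u) :
    ∃ V w, IsProfile u V ∧ IsRadialSolution N p μ m f V w ∧
      IntegrableOn (fun r => r ^ (N - 1) * |V r| ^ p) (Set.Ioi 0) ∧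
      IntegrableOn (fun r => r ^ (N - 1) * |w r| ^ p) (Set.Ioi 0) := by
  obtain ⟨⟨G, ⟨huLp, hGLp, hG⟩, hsub⟩, ⟨G', ⟨-, -, hG'⟩, hsup⟩⟩ := hu
  obtain ⟨v₀, hv₀⟩ := hrad
  have hp0 : 0 < p := by linarith
  -- The two inequalities come with a priori different weak gradients, which agree a.e.
  have hsol : ∀ φ : E N → ℝ, IsTestFunction φ → (∀ x, 0 ≤ φ x) →
      weakForm p μ m u G φ = ∫ x, f (u x) * φ x := by
    intro φ hφ hφ0
    refine le_antisymm (hsub φ hφ hφ0).2 ((hsup φ hφ hφ0).2.trans (le_of_eq ?_))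
    exact integral_congr_ae ((hG'.ae_unique hG).mono fun x hx => by simp only [hx])
  obtain ⟨w, hw⟩ := hG.hasWeakDeriv_profile hN hv₀
  obtain ⟨C, hC⟩ := hw.ae_eq_primitive
  set V : ℝ → ℝ := fun r => C + ∫ s in (1 : ℝ)..r, w s with hV
  have huV : IsProfile u V := by
    filter_upwards [hv₀, (ae_radial_iff hN (P := fun r => v₀ r = V r)).2 hC] with x h1 h2
    rw [h1, h2]
  have hVc : ContinuousOn V (Set.Ioi 0) :=
    continuousOn_const.add (continuousOn_primitive_Ioi hw.right)
  have hGr := hG.ae_eq_radial hN hw.right huV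
  have hpe : ENNReal.ofReal p ≠ 0 := (ENNReal.ofReal_pos.2 hp0).ne'
  have hVp : IntegrableOn (fun r => r ^ (N - 1) * |V r| ^ p) (Set.Ioi 0) := by
    refine (integrable_radial_iff hN (g := fun r => |V r| ^ p)).1 ?_
    refine (huLp.integrable_norm_rpow hpe ENNReal.ofReal_ne_top).congr ?_
    filter_upwards [huV] with x hx
    rw [ENNReal.toReal_ofReal hp0.le, Real.norm_eq_abs, hx]
  have hwp : IntegrableOn (fun r => r ^ (N - 1) * |w r| ^ p) (Set.Ioi 0) := by
    refine (integrable_radial_iff hN (g := fun r => |w r| ^ p)).1 ?_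
    refine (hGLp.integrable_norm_rpow hpe ENNReal.ofReal_ne_top).congr ?_
    filter_upwards [hGr] with x hx
    have hx0 : ‖x‖ ≠ 0 := norm_ne_zero_iff.2 hx.1
    rw [ENNReal.toReal_ofReal hp0.le, hx.2, norm_smul, norm_div, norm_norm, Real.norm_eq_abs]
    field_simp
  obtain ⟨hgc, hflux⟩ := hasWeakDeriv_flux hN hp hf hsol huV hVc hGr
    (locallyIntegrableOn_flux hp hw.right hwp)
  obtain ⟨C', hC'⟩ := hflux.ae_eq_primitive
  set g : ℝ → ℝ := fun r =>
    r ^ (N - 1) * ((m - μ / r ^ p) * (|V r| ^ (p - 2) * V r) - f (V r)) with hg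
  set Φ : ℝ → ℝ := fun r => C' + ∫ s in (1 : ℝ)..r, g s with hΦ
  have primitive : ∀ {z : ℝ → ℝ}, ContinuousOn z (Set.Ioi 0) → ∀ r, 0 < r → ∀ c : ℝ,
      HasDerivAt (fun r => c + ∫ s in (1 : ℝ)..r, z s) (z r) r := by
    intro z hz r hr c
    refine (intervalIntegral.integral_hasDerivAt_right
      ((hz.locallyIntegrableOn measurableSet_Ioi).intervalIntegrable_of_pos one_pos hr)
      (hz.stronglyMeasurableAtFilter isOpen_Ioi r hr)
      (hz.continuousAt (Ioi_mem_nhds hr))).const_add c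
  have hΦc : ContinuousOn Φ (Set.Ioi 0) := fun r hr =>
    (primitive hgc r hr C').continuousAt.continuousWithinAt
  -- the derivative is recovered from the continuous flux through the conjugate exponent
  set q : ℝ := p / (p - 1) with hq
  have hp1 : 0 < p - 1 := by linarith
  have hpq : (p - 1) * (q - 1) = 1 := by
    rw [hq]
    field_simp
    ring
  have hq1 : 1 < q := by
    rw [hq, lt_div_iff₀ hp1]
    linarith
  set W : ℝ → ℝ := fun r => |Φ r / r ^ (N - 1)| ^ (q - 2) * (Φ r / r ^ (N - 1)) with hW
  have hWc : ContinuousOn W (Set.Ioi 0) :=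
    (continuous_abs_rpow_mul_self hq1).comp_continuousOn
      (hΦc.div (continuousOn_pow _) fun r hr => (pow_pos hr _).ne')
  have hwW : ∀ᵐ r ∂volume.restrict (Set.Ioi (0 : ℝ)), w r = W r := by
    filter_upwards [hC', ae_restrict_mem measurableSet_Ioi] with r hr hr0
    have hrN : r ^ (N - 1) ≠ 0 := (pow_pos hr0 _).ne'
    have e : Φ r / r ^ (N - 1) = |w r| ^ (p - 2) * w r := by
      rw [div_eq_iff hrN, mul_comm]
      exact hr.symm
    simp only [hW, e, abs_rpow_mul_self_inverse hpq]
  have hVW : ∀ r, 0 < r → V r = C + ∫ s in (1 : ℝ)..r, W s := by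
    intro r hr
    simp only [hV]
    congr 1
    refine intervalIntegral.integral_congr_ae ?_
    filter_upwards [(ae_restrict_iff' measurableSet_Ioi).1 hwW] with s hs hs'
    refine hs ?_
    rcases Set.mem_uIoc.1 hs' with h | h
    · exact one_pos.trans h.1
    · exact hr.trans h.1
  refine ⟨V, W, huV, ⟨fun r hr => ?_, hWc, fun r hr => ?_⟩, hVp, ?_⟩
  · refine (primitive hWc r hr C).congr_of_eventuallyEq ?_
    filter_upwards [Ioi_mem_nhds hr] with s hs using hVW s hs
  · refine (primitive hgc r hr C').congr_of_eventuallyEq ?_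
    filter_upwards [Ioi_mem_nhds hr] with s hs
    have hsN : s ^ (N - 1) ≠ 0 := (pow_pos hs _).ne'
    rw [hW, abs_rpow_mul_self_inverse (by rw [mul_comm]; exact hpq), mul_div_cancel₀ _ hsN]
  · refine hwp.congr_fun_ae ?_
    filter_upwards [hwW] with r hr
    rw [hr]

end

end HardyPLaplace

theorem theorem2p1 (N : ℕ) (p μ m q A : ℝ) (hp : 1 < p) (hpN : p < N)
    (hμ0 : 0 ≤ μ) (hμ : μ < (((N : ℝ) - p) / p) ^ p) (hm : 0 < m)
    (f : ℝ → ℝ) (hf : Continuous f) (hq : p < q) (hfA : HardyPLaplace.GrowthAtZero f q A)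
    (u : HardyPLaplace.E N → ℝ) (hu : HardyPLaplace.IsWeakSolution p μ m f u)
    (hu_rad : HardyPLaplace.IsRadial u) (hu_pos : ∀ᵐ x : HardyPLaplace.E N, 0 < u x)
    (k : ℕ) (hk : (k : ℝ) ≤ p) (hk' : p < (k : ℝ) + 1) :
    ∃ c : ℕ → ℝ,
      -- the coefficients exist and are determined uniquely
      HardyPLaplace.IsCoeffs N p m k c ∧
      (∀ c' : ℕ → ℝ, HardyPLaplace.IsCoeffs N p m k c' → ∀ i ≤ k, c' i = c i) ∧
      -- `v` is the continuously differentiable profile `r ↦ u(r)` on `(0, ∞)`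
      ∃ v : ℝ → ℝ,
        HardyPLaplace.IsProfile u v ∧ ContDiffOn ℝ 1 v (Set.Ioi 0) ∧ (∀ r, 0 < r → 0 < v r) ∧
        (∀ᶠ r in atTop, deriv v r < 0) ∧
        (fun r : ℝ => (-(deriv v r / v r)) ^ (p - 1) -
            (∑ i ∈ Finset.range (k + 1), c i / r ^ i
              - ((p - 1) / m) ^ (1 / p) * μ / (p * r ^ p)))
          =O[atTop] (fun r : ℝ => 1 / r ^ (k + 1)) := by
  have hN : 1 ≤ N := by
    have : (1 : ℝ) < N := hp.trans hpN
    exact_mod_cast this.le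
  obtain ⟨c, hc⟩ := HardyPLaplace.exists_isCoeffs N hp hm k
  obtain ⟨B, t₀, hB, ht₀, hfB⟩ := hfA.exists_bound hf (hp.trans hq)
  obtain ⟨v, w, hprof, hv, hvi, hwi⟩ := hu.exists_isRadialSolution hN hp hf hu_rad
  have hae : ∀ᵐ r ∂volume.restrict (Set.Ioi (0 : ℝ)), 0 < v r := by
    rw [← HardyPLaplace.ae_radial_iff hN]
    filter_upwards [hprof, hu_pos] with x h1 h2
    rwa [← h1]
  have hpos := hv.pos hp hμ0 hm hq.le hB ht₀ hfB hae
  have hlim := hv.tendsto_zero hp hpos (hvi.congr_fun (fun r hr => by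
    simp only [abs_of_pos (hpos r hr)]) measurableSet_Ioi) hwi
  obtain ⟨hneg, hO⟩ := hv.riccati_isBigO hN hp hm hq hB ht₀ hfB hpos hlim hk hk' hc
  have hderiv : ∀ r, 0 < r → deriv v r = w r := fun r hr => (hv.hasDerivAt r hr).deriv
  refine ⟨c, hc, fun c' hc' => hc.unique hp hm hc', v, hprof, ?_, hpos, ?_, ?_⟩
  · refine (contDiffOn_one_iff_derivWithin (uniqueDiffOn_Ioi 0)).2 ⟨fun r hr =>
      (hv.hasDerivAt r hr).differentiableAt.differentiableWithinAt, ?_⟩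
    refine hv.continuousOn_deriv.congr fun r hr => ?_
    rw [derivWithin_of_isOpen isOpen_Ioi hr, hderiv r hr]
  · filter_upwards [hneg, eventually_gt_atTop 0] with r h1 h2
    rwa [hderiv r h2]
  · refine hO.congr' ?_ EventuallyEq.rfl
    filter_upwards [eventually_gt_atTop 0] with r hr
    rw [hderiv r hr, HardyPLaplace.expansion]
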